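/- Let $\mathcal H$ be a complex Hilbert space, let $\mathcal B(\mathcal H)_*$ be the space of normal linear functionals on $\mathcal B(\mathcal H)$, and let $V$ be a multiplicative unitary on $\mathcal H\otimes\mathcal H$ (Hilbert space tensor product), i.e. a unitary operator that satisfies the pentagon equation $V_{12}V_{13}V_{23}=V_{23}V_{12}$ on $\mathcal H\otimes\mathcal H\otimes\mathcal H$. The right leg of $V$ is $A_0=\{(\omega\otimes\iota)V : \omega\in\mathcal B(\mathcal H)_*\}$ and the left leg is $\widehat A_0=\{(\iota\otimes\omega)V : \omega\in\mathcal B(\mathcal H)_*\}$; both are subspaces of $\mathcal B(\mathcal H)$. Say that a (not necessarily everywhere defined) linear operator $S$ on $\mathcal B(\mathcal H)$ has a polar decomposition if $S=R\circ\tau_{-i/2}$, with equality of domains, where $R$ is a linear involutive $^*$-anti-automorphism of $\mathcal B(\mathcal H)$, $(\tau_t)_{t\in\mathbb R}$ is a $\sigma$-weakly continuous one-parameter group of $^*$-automorphisms of $\mathcal B(\mathcal H)$, and $\tau_{-i/2}$ is its analytic extension: $x$ is in the domain of $\tau_{-i/2}$ with $\tau_{-i/2}(x)=y$ if and only if there is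 a function $F$ from the strip $\{z\in\mathbb C : -\tfrac12\le \operatorname{Im} z\le 0\}$ to $\mathcal B(\mathcal H)$, $\sigma$-weakly continuous on the strip and holomorphic in its interior (that is, $\omega\circ F$ is so for every $\omega\in\mathcal B(\mathcal H)_*$), with $F(t)=\tau_t(x)$ for all $t\in\mathbb R$ and $F(-i/2)=y$. Such an operator $S$ is automatically closed. Assume that $V$ has manageable antipodes: there are linear operators $S$ and $\widehat S$ on $\mathcal B(\mathcal H)$, each with a polar decomposition, such that for all $\omega\in\mathcal B(\mathcal H)_*$ the element $(\omega\otimes\iota)V$ lies in the domain of $S$ with $S((\omega\otimes\iota)V)=(\omega\otimes\iota)V^*$, and the element $(\iota\otimes\omega)V$ lies in the domain of $\widehat S$ with $\widehat S((\iota\otimes\omega)V)=(\iota\otimes\omega)V^*$. Then the norm closures of $A_0$ and of $\widehat A_0$, and the $\sigma$-weak closures of $A_0$ and of $\widehat A_0$, are self-adjoint (closed under $x\mapsto x^*$). -/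

import Mathlib

open scoped TensorProduct InnerProductSpace ComplexConjugate

noncomputable section

namespace MultUnitary

/-! ### Hilbert space tensor products and leg numbering -/

section Tensor

variable (E F : Type*) [NormedAddCommGroup E] [InnerProductSpace ℂ E]
  [NormedAddCommGroup F] [InnerProductSpace ℂ F]

/-- The Hilbert space tensor product of `E` and `F`: the completion of the algebraic tensor
product for the inner product `⟪a ⊗ b, c ⊗ d⟫ = ⟪a, c⟫ * ⟪b, d⟫`. -/
abbrev HTensor : Type _ := UniformSpace.Completion (E ⊗[ℂ] F)

variable {E F}

/-- The operator `y ↦ x ⊗ y`. -/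
def ketLeft (x : E) : F →L[ℂ] HTensor E F :=
  UniformSpace.Completion.toComplL ∘L TensorProduct.mkL ℂ E F x

/-- The operator `x ↦ x ⊗ y`. -/
def ketRight (y : F) : E →L[ℂ] HTensor E F :=
  UniformSpace.Completion.toComplL ∘L (TensorProduct.mkL ℂ E F).flip y

theorem ketLeft_apply (x : E) (y : F) :
    ketLeft x y = ((x ⊗ₜ[ℂ] y : E ⊗[ℂ] F) : HTensor E F) := rfl

theorem ketRight_apply (x : E) (y : F) :
    ketRight y x = ((x ⊗ₜ[ℂ] y : E ⊗[ℂ] F) : HTensor E F) := rfl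

theorem ketLeft_add (x x' : E) : (ketLeft (x + x') : F →L[ℂ] HTensor E F) =
    ketLeft x + ketLeft x' := by
  ext y; simp [ketLeft]

theorem ketLeft_smul (c : ℂ) (x : E) : (ketLeft (c • x) : F →L[ℂ] HTensor E F) =
    c • ketLeft x := by
  ext y; simp [ketLeft]

theorem ketRight_add (y y' : F) : (ketRight (y + y') : E →L[ℂ] HTensor E F) =
    ketRight y + ketRight y' := by
  ext x; simp [ketRight]

theorem ketRight_smul (c : ℂ) (y : F) : (ketRight (c • y) : E →L[ℂ] HTensor E F) =
    c • ketRight y := by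
  ext x; simp [ketRight]

theorem norm_ketLeft_le (x : E) : ‖(ketLeft x : F →L[ℂ] HTensor E F)‖ ≤ ‖x‖ :=
  ContinuousLinearMap.opNorm_le_bound _ (norm_nonneg _) fun y => by
    rw [ketLeft_apply, UniformSpace.Completion.norm_coe, TensorProduct.norm_tmul]

theorem norm_ketRight_le (y : F) : ‖(ketRight y : E →L[ℂ] HTensor E F)‖ ≤ ‖y‖ :=
  ContinuousLinearMap.opNorm_le_bound _ (norm_nonneg _) fun x => by
    rw [ketRight_apply, UniformSpace.Completion.norm_coe, TensorProduct.norm_tmul, mul_comm]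

variable {G : Type*} [NormedAddCommGroup G] [InnerProductSpace ℂ G]

variable (G) in
/-- The operator `1 ⊗ T`. -/
def ampRight (T : E →L[ℂ] F) : HTensor G E →L[ℂ] HTensor G F := (T.lTensor G).completion

variable (G) in
/-- The operator `T ⊗ 1`. -/
def ampLeft (T : E →L[ℂ] F) : HTensor E G →L[ℂ] HTensor F G := (T.rTensor G).completion

theorem ampRight_coe (T : E →L[ℂ] F) (u : G ⊗[ℂ] E) :
    ampRight G T (u : HTensor G E) = ((T.lTensor G u : G ⊗[ℂ] F) : HTensor G F) :=
  UniformSpace.Completion.map_coe (T.lTensor G).uniformContinuous u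

theorem ampLeft_coe (T : E →L[ℂ] F) (u : E ⊗[ℂ] G) :
    ampLeft G T (u : HTensor E G) = ((T.rTensor G u : F ⊗[ℂ] G) : HTensor F G) :=
  UniformSpace.Completion.map_coe (T.rTensor G).uniformContinuous u

variable (E F) in
/-- The flip `x ⊗ y ↦ y ⊗ x`. -/
def flip : HTensor E F →L[ℂ] HTensor F E :=
  ((TensorProduct.commIsometry ℂ E F).toContinuousLinearEquiv : E ⊗[ℂ] F →L[ℂ] F ⊗[ℂ] E).completion

/-- For `z : G`, the operator `x ⊗ y ↦ x ⊗ (y ⊗ z)`. -/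
def insertThird (z : G) : HTensor E F →L[ℂ] HTensor E (HTensor F G) :=
  ampRight E (ketRight z)

theorem insertThird_coe_tmul (z : G) (x : E) (y : F) :
    insertThird z ((x ⊗ₜ[ℂ] y : E ⊗[ℂ] F) : HTensor E F) = ketLeft x (ketLeft y z) := by
  rw [insertThird, ampRight_coe]
  rfl

variable (G) in
theorem ampRight_add (T T' : E →L[ℂ] F) : ampRight G (T + T') = ampRight G T + ampRight G T' := by
  ext u
  induction u using UniformSpace.Completion.induction_on with
  | hp => exact isClosed_eq (by fun_prop) (by fun_prop)
  | ih u =>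
    rw [_root_.add_apply, ampRight_coe, ampRight_coe, ampRight_coe,
      ContinuousLinearMap.lTensor_add, _root_.add_apply,
      UniformSpace.Completion.coe_add]

variable (G) in
theorem ampRight_smul (c : ℂ) (T : E →L[ℂ] F) : ampRight G (c • T) = c • ampRight G T := by
  ext u
  induction u using UniformSpace.Completion.induction_on with
  | hp => exact isClosed_eq (ampRight G (c • T)).continuous (c • ampRight G T).continuous
  | ih u =>
    rw [_root_.smul_apply, ampRight_coe, ampRight_coe,
      ContinuousLinearMap.lTensor_smul, _root_.smul_apply,
      UniformSpace.Completion.coe_smul]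

theorem insertThird_add (z z' : G) : (insertThird (z + z') : HTensor E F →L[ℂ] _) =
    insertThird z + insertThird z' := by
  rw [insertThird, ketRight_add, ampRight_add]; rfl

theorem insertThird_smul (c : ℂ) (z : G) : (insertThird (c • z) : HTensor E F →L[ℂ] _) =
    c • insertThird z := by
  rw [insertThird, ketRight_smul, ampRight_smul]; rfl

theorem inner_insertThird (z z' : G) (u u' : HTensor E F) :
    ⟪insertThird z u, insertThird z' u'⟫_ℂ = ⟪u, u'⟫_ℂ * ⟪z, z'⟫_ℂ := by
  induction u, u' using UniformSpace.Completion.induction_on₂ with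
  | hp => exact isClosed_eq (by fun_prop) (by fun_prop)
  | ih u u' =>
    induction u with
    | zero => rw [UniformSpace.Completion.coe_zero, map_zero, inner_zero_left, inner_zero_left,
        zero_mul]
    | add a b ha hb =>
      rw [UniformSpace.Completion.coe_add, map_add, inner_add_left, ha, hb, inner_add_left,
        add_mul]
    | tmul x y =>
      induction u' with
      | zero => rw [UniformSpace.Completion.coe_zero, map_zero, inner_zero_right, inner_zero_right,
          zero_mul]
      | add a b ha hb =>
        rw [UniformSpace.Completion.coe_add, map_add, inner_add_right, ha, hb, inner_add_right,
          add_mul]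
      | tmul x' y' =>
        rw [insertThird_coe_tmul, insertThird_coe_tmul]
        simp [ketLeft_apply, UniformSpace.Completion.inner_coe, mul_assoc]

/-- A bilinear map `B` with `⟪B u z, B u' z'⟫ = ⟪u, u'⟫ * ⟪z, z'⟫` extends to an isometry on the
Hilbert space tensor product. -/
def liftIsometry (B : E →ₗ[ℂ] F →ₗ[ℂ] G)
    (hB : ∀ u u' z z', ⟪B u z, B u' z'⟫_ℂ = ⟪u, u'⟫_ℂ * ⟪z, z'⟫_ℂ) : E ⊗[ℂ] F →ₗᵢ[ℂ] G :=
  (TensorProduct.lift B).isometryOfInner fun s t => by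
    induction s with
    | zero => simp
    | add a b ha hb => rw [map_add, inner_add_left, ha, hb, inner_add_left]
    | tmul u z =>
      induction t with
      | zero => simp
      | add a b ha hb => rw [map_add, inner_add_right, ha, hb, inner_add_right]
      | tmul u' z' =>
        rw [TensorProduct.lift.tmul, TensorProduct.lift.tmul, hB, TensorProduct.inner_tmul]

variable (E F G) in
/-- The algebraic part `u ⊗ z ↦ insertThird z u` of the associativity operator. -/
def assocBilin : HTensor E F →ₗ[ℂ] G →ₗ[ℂ] HTensor E (HTensor F G) :=
  LinearMap.mk₂ ℂ (fun u z => insertThird z u)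
    (fun u u' z => map_add _ u u') (fun c u z => map_smul _ c u)
    (fun u z z' => by rw [insertThird_add]; rfl)
    (fun c u z => by rw [insertThird_smul]; rfl)

variable (E F G) in
/-- The associativity operator `(x ⊗ y) ⊗ z ↦ x ⊗ (y ⊗ z)`, a unitary. -/
def assoc : HTensor (HTensor E F) G →L[ℂ] HTensor E (HTensor F G) :=
  (liftIsometry (assocBilin E F G) fun u u' z z' =>
    inner_insertThird z z' u u').toContinuousLinearMap.fromCompletion

theorem assoc_ketRight (u : HTensor E F) (z : G) : assoc E F G (ketRight z u) = insertThird z u := by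
  rw [ketRight_apply, assoc, ContinuousLinearMap.fromCompletion_apply_coe]
  rfl

theorem norm_assoc (s : HTensor (HTensor E F) G) : ‖assoc E F G s‖ = ‖s‖ := by
  induction s using UniformSpace.Completion.induction_on with
  | hp => exact isClosed_eq (by fun_prop) (by fun_prop)
  | ih s =>
    rw [assoc, ContinuousLinearMap.fromCompletion_apply_coe, UniformSpace.Completion.norm_coe]
    exact LinearIsometry.norm_map _ s

theorem adjoint_assoc_assoc (s : HTensor (HTensor E F) G) :
    (assoc E F G).adjoint (assoc E F G s) = s := by
  have h := (ContinuousLinearMap.norm_map_iff_adjoint_comp_self (assoc E F G)).1 norm_assoc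
  exact congrArg (fun T : _ →L[ℂ] _ => T s) h

end Tensor

section Legs

variable {H : Type*} [NormedAddCommGroup H] [InnerProductSpace ℂ H]

/-- `V₁₂` on `H ⊗ (H ⊗ H)`: the operator `V ⊗ 1` on `(H ⊗ H) ⊗ H`, transported along the
associativity unitary. -/
def leg12 (V : HTensor H H →L[ℂ] HTensor H H) :
    HTensor H (HTensor H H) →L[ℂ] HTensor H (HTensor H H) :=
  assoc H H H ∘L ampLeft H V ∘L (assoc H H H).adjoint

/-- `V₂₃` on `H ⊗ (H ⊗ H)`. -/
def leg23 (V : HTensor H H →L[ℂ] HTensor H H) :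
    HTensor H (HTensor H H) →L[ℂ] HTensor H (HTensor H H) :=
  ampRight H V

/-- `V₁₃` on `H ⊗ (H ⊗ H)`: `V₁₂` conjugated by the flip of the last two factors. -/
def leg13 (V : HTensor H H →L[ℂ] HTensor H H) :
    HTensor H (HTensor H H) →L[ℂ] HTensor H (HTensor H H) :=
  ampRight H (flip H H) ∘L leg12 V ∘L ampRight H (flip H H)

/-- `V₁₂ ((x ⊗ y) ⊗ z) = V (x ⊗ y) ⊗ z`. -/
theorem leg12_insertThird (V : HTensor H H →L[ℂ] HTensor H H) (u : HTensor H H) (z : H) :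
    leg12 V (insertThird z u) = insertThird z (V u) := by
  have h : ampLeft H V (ketRight z u) = ketRight z (V u) := by
    rw [ketRight_apply, ampLeft_coe]
    rfl
  rw [leg12, ← assoc_ketRight, ContinuousLinearMap.comp_apply, ContinuousLinearMap.comp_apply,
    adjoint_assoc_assoc, h, assoc_ketRight]

/-- A multiplicative unitary: a unitary `V` on `H ⊗ H` that satisfies the pentagon equation
`V₁₂ V₁₃ V₂₃ = V₂₃ V₁₂`. -/
structure IsMultiplicativeUnitary [CompleteSpace H] (V : HTensor H H →L[ℂ] HTensor H H) :
    Prop where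
  unitary : V ∈ unitary (HTensor H H →L[ℂ] HTensor H H)
  pentagon : leg12 V * leg13 V * leg23 V = leg23 V * leg12 V

end Legs

/-! ### The predual, the σ-weak topology and slice maps -/

section Predual

variable (H : Type*) [NormedAddCommGroup H] [InnerProductSpace ℂ H]

/-- The predual of `B(H)`: the normal functionals `x ↦ ∑ ⟪η n, x (ξ n)⟫` with
`∑ ‖ξ n‖ ^ 2 < ∞` and `∑ ‖η n‖ ^ 2 < ∞`. -/
def predual : Set (StrongDual ℂ (H →L[ℂ] H)) :=
  {ω | ∃ ξ η : ℕ → H, Summable (fun n => ‖ξ n‖ ^ 2) ∧ Summable (fun n => ‖η n‖ ^ 2) ∧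
    ∀ x : H →L[ℂ] H, HasSum (fun n => ⟪η n, x (ξ n)⟫_ℂ) (ω x)}

/-- The σ-weak topology of `B(H)`: the weakest topology for which all normal functionals are
continuous. -/
@[reducible] def sigmaWeakTopology : TopologicalSpace (H →L[ℂ] H) :=
  ⨅ ω ∈ predual H, TopologicalSpace.induced (fun x => ω x) inferInstance

variable {H}

/-- The closure of a set of operators in the σ-weak topology. -/
def sigmaWeakClosure (A : Set (H →L[ℂ] H)) : Set (H →L[ℂ] H) :=
  @closure _ (sigmaWeakTopology H) A

/-- A set of operators that is closed under taking adjoints. -/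
def IsSelfAdjointSet [CompleteSpace H] (A : Set (H →L[ℂ] H)) : Prop :=
  ∀ x ∈ A, star x ∈ A

variable [CompleteSpace H]

/-- The form `(b, a) ↦ ω ((ι ⊗ ω_{a,b}) V)`, where `(ι ⊗ ω_{a,b}) V` is the operator `T` with
`⟪d, T c⟫ = ⟪d ⊗ b, V (c ⊗ a)⟫`. -/
def rightSliceForm (ω : StrongDual ℂ (H →L[ℂ] H)) (V : HTensor H H →L[ℂ] HTensor H H) :
    H →L⋆[ℂ] H →L[ℂ] ℂ :=
  LinearMap.mkContinuous₂
    (LinearMap.mk₂'ₛₗ (starRingEnd ℂ) (RingHom.id ℂ)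
      (fun b a => ω ((ketRight b).adjoint ∘L V ∘L ketRight a))
      (fun b b' a => by
        rw [ketRight_add, map_add, ContinuousLinearMap.add_comp, map_add])
      (fun c b a => by
        rw [ketRight_smul, map_smulₛₗ, ContinuousLinearMap.smul_comp, map_smul])
      (fun b a a' => by
        rw [ketRight_add, ContinuousLinearMap.comp_add, ContinuousLinearMap.comp_add, map_add])
      (fun c b a => by
        rw [ketRight_smul, ContinuousLinearMap.comp_smul, ContinuousLinearMap.comp_smul, map_smul]
        rfl))
    (‖ω‖ * ‖V‖) fun b a => by
      calc ‖ω ((ketRight b).adjoint ∘L V ∘L ketRight a)‖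
          ≤ ‖ω‖ * ‖(ketRight b).adjoint ∘L V ∘L ketRight a‖ := ω.le_opNorm _
        _ ≤ ‖ω‖ * (‖b‖ * (‖V‖ * ‖a‖)) := by
            gcongr
            refine (ContinuousLinearMap.opNorm_comp_le _ _).trans ?_
            gcongr
            · rw [LinearIsometryEquiv.norm_map]; exact norm_ketRight_le b
            · refine (ContinuousLinearMap.opNorm_comp_le _ _).trans ?_
              gcongr
              exact norm_ketRight_le a
        _ = ‖ω‖ * ‖V‖ * ‖b‖ * ‖a‖ := by ring

/-- The form `(b, a) ↦ ω ((ω_{a,b} ⊗ ι) V)`, where `(ω_{a,b} ⊗ ι) V` is the operator `T` with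
`⟪d, T c⟫ = ⟪b ⊗ d, V (a ⊗ c)⟫`. -/
def leftSliceForm (ω : StrongDual ℂ (H →L[ℂ] H)) (V : HTensor H H →L[ℂ] HTensor H H) :
    H →L⋆[ℂ] H →L[ℂ] ℂ :=
  LinearMap.mkContinuous₂
    (LinearMap.mk₂'ₛₗ (starRingEnd ℂ) (RingHom.id ℂ)
      (fun b a => ω ((ketLeft b).adjoint ∘L V ∘L ketLeft a))
      (fun b b' a => by
        rw [ketLeft_add, map_add, ContinuousLinearMap.add_comp, map_add])
      (fun c b a => by
        rw [ketLeft_smul, map_smulₛₗ, ContinuousLinearMap.smul_comp, map_smul])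
      (fun b a a' => by
        rw [ketLeft_add, ContinuousLinearMap.comp_add, ContinuousLinearMap.comp_add, map_add])
      (fun c b a => by
        rw [ketLeft_smul, ContinuousLinearMap.comp_smul, ContinuousLinearMap.comp_smul, map_smul]
        rfl))
    (‖ω‖ * ‖V‖) fun b a => by
      calc ‖ω ((ketLeft b).adjoint ∘L V ∘L ketLeft a)‖
          ≤ ‖ω‖ * ‖(ketLeft b).adjoint ∘L V ∘L ketLeft a‖ := ω.le_opNorm _
        _ ≤ ‖ω‖ * (‖b‖ * (‖V‖ * ‖a‖)) := by
            gcongr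
            refine (ContinuousLinearMap.opNorm_comp_le _ _).trans ?_
            gcongr
            · rw [LinearIsometryEquiv.norm_map]; exact norm_ketLeft_le b
            · refine (ContinuousLinearMap.opNorm_comp_le _ _).trans ?_
              gcongr
              exact norm_ketLeft_le a
        _ = ‖ω‖ * ‖V‖ * ‖b‖ * ‖a‖ := by ring

/-- The slice `(ω ⊗ ι) V`. -/
def rightSlice (ω : StrongDual ℂ (H →L[ℂ] H)) (V : HTensor H H →L[ℂ] HTensor H H) : H →L[ℂ] H :=
  (InnerProductSpace.continuousLinearMapOfBilin (rightSliceForm ω V)).adjoint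

/-- The slice `(ι ⊗ ω) V`. -/
def leftSlice (ω : StrongDual ℂ (H →L[ℂ] H)) (V : HTensor H H →L[ℂ] HTensor H H) : H →L[ℂ] H :=
  (InnerProductSpace.continuousLinearMapOfBilin (leftSliceForm ω V)).adjoint

/-- `⟪b, (ω ⊗ ι)(V) a⟫ = ω ((ι ⊗ ω_{a,b}) V)`. -/
theorem inner_rightSlice (ω : StrongDual ℂ (H →L[ℂ] H)) (V : HTensor H H →L[ℂ] HTensor H H)
    (b a : H) :
    ⟪b, rightSlice ω V a⟫_ℂ = ω ((ketRight b).adjoint ∘L V ∘L ketRight a) := by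
  rw [rightSlice, ContinuousLinearMap.adjoint_inner_right,
    InnerProductSpace.continuousLinearMapOfBilin_apply]
  rfl

/-- `⟪b, (ι ⊗ ω)(V) a⟫ = ω ((ω_{a,b} ⊗ ι) V)`. -/
theorem inner_leftSlice (ω : StrongDual ℂ (H →L[ℂ] H)) (V : HTensor H H →L[ℂ] HTensor H H)
    (b a : H) :
    ⟪b, leftSlice ω V a⟫_ℂ = ω ((ketLeft b).adjoint ∘L V ∘L ketLeft a) := by
  rw [leftSlice, ContinuousLinearMap.adjoint_inner_right,
    InnerProductSpace.continuousLinearMapOfBilin_apply]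
  rfl

/-- The right leg of `V`: the operators `(ω ⊗ ι) V` with `ω` normal. -/
def rightLeg (V : HTensor H H →L[ℂ] HTensor H H) : Set (H →L[ℂ] H) :=
  {x | ∃ ω ∈ predual H, x = rightSlice ω V}

/-- The left leg of `V`: the operators `(ι ⊗ ω) V` with `ω` normal. -/
def leftLeg (V : HTensor H H →L[ℂ] HTensor H H) : Set (H →L[ℂ] H) :=
  {x | ∃ ω ∈ predual H, x = leftSlice ω V}

end Predual

/-! ### Polar decomposition of an antipode and manageable antipodes -/

section Antipode

variable {H : Type*} [NormedAddCommGroup H] [InnerProductSpace ℂ H] [CompleteSpace H]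

/-- A linear involutive `*`-anti-automorphism of `B(H)`. -/
structure IsInvolutiveStarAntiAut (R : (H →L[ℂ] H) →ₗ[ℂ] (H →L[ℂ] H)) : Prop where
  map_mul : ∀ x y, R (x * y) = R y * R x
  map_star : ∀ x, R (star x) = star (R x)
  involutive : ∀ x, R (R x) = x

/-- A σ-weakly continuous one-parameter group of `*`-automorphisms of `B(H)`. -/
structure IsOneParameterGroup (τ : ℝ → ((H →L[ℂ] H) ≃⋆ₐ[ℂ] (H →L[ℂ] H))) : Prop where
  zero : ∀ x, τ 0 x = x
  add : ∀ s t x, τ (s + t) x = τ s (τ t x)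
  continuous : ∀ x, ∀ ω ∈ predual H, Continuous fun t => ω (τ t x)

/-- The graph of the analytic extension `τ_w`, `w ∈ ℂ`: `x` lies in the domain of `τ_w` and
`τ_w x = y` if and only if there is a function `F` with `F t = τ_t x` for real `t` and `F w = y`
that is σ-weakly continuous on the closed horizontal strip between `ℝ` and `ℝ + w` and
holomorphic in its interior. -/
def IsAnalyticExtension (τ : ℝ → ((H →L[ℂ] H) ≃⋆ₐ[ℂ] (H →L[ℂ] H))) (w : ℂ) (x y : H →L[ℂ] H) :
    Prop :=
  ∃ F : ℂ → (H →L[ℂ] H), (∀ t : ℝ, F t = τ t x) ∧ F w = y ∧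
    ∀ ω ∈ predual H,
      ContinuousOn (fun z => ω (F z)) {z : ℂ | z.im ∈ Set.uIcc 0 w.im} ∧
      DifferentiableOn ℂ (fun z => ω (F z)) {z : ℂ | z.im ∈ Set.uIoo 0 w.im}

/-- The (in general unbounded) operator `S` on `B(H)` has a polar decomposition: `S = R ∘ τ_{-i/2}`
(with equality of domains) for a linear involutive `*`-anti-automorphism `R` and a σ-weakly
continuous one-parameter group `τ` of `*`-automorphisms. -/
def HasPolarDecomposition (S : (H →L[ℂ] H) →ₗ.[ℂ] (H →L[ℂ] H)) : Prop :=
  ∃ (R : (H →L[ℂ] H) →ₗ[ℂ] (H →L[ℂ] H)) (τ : ℝ → ((H →L[ℂ] H) ≃⋆ₐ[ℂ] (H →L[ℂ] H))),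
    IsInvolutiveStarAntiAut R ∧ IsOneParameterGroup τ ∧
    ∀ x y, (x, y) ∈ S.graph ↔ ∃ x', IsAnalyticExtension τ (-Complex.I / 2) x x' ∧ y = R x'

/-- `V` is a multiplicative unitary with manageable antipodes: there are operators `S` and `S'` on
`B(H)` with a polar decomposition, such that every `(ω ⊗ ι) V` lies in the domain of `S`, with
`S ((ω ⊗ ι) V) = (ω ⊗ ι) V*`, and every `(ι ⊗ ω) V` lies in the domain of `S'`, with
`S' ((ι ⊗ ω) V) = (ι ⊗ ω) V*`. -/
structure HasManageableAntipodes (V : HTensor H H →L[ℂ] HTensor H H) : Prop where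
  isMultiplicativeUnitary : IsMultiplicativeUnitary V
  right : ∃ S : (H →L[ℂ] H) →ₗ.[ℂ] (H →L[ℂ] H), HasPolarDecomposition S ∧
    ∀ ω ∈ predual H, (rightSlice ω V, rightSlice ω (star V)) ∈ S.graph
  left : ∃ S' : (H →L[ℂ] H) →ₗ.[ℂ] (H →L[ℂ] H), HasPolarDecomposition S' ∧
    ∀ ω ∈ predual H, (leftSlice ω V, leftSlice ω (star V)) ∈ S'.graph

end Antipode

end MultUnitary

end

/-!
The right leg `{(ω ⊗ ι) V}` is handled with the antipode of the left leg, and conversely; the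
pentagon equation plays no role. Write `S' = R ∘ τ_{-i/2}` for the antipode of the left leg, so that
formally `(S' ⊗ ι) V = V*`. Since `((ω ⊗ ι) V)* = (ω' ⊗ ι) V*` for the conjugate functional `ω'`, it
suffices that `(θ ⊗ ι) V*` lies in the norm closure of the right leg for every normal `θ`. If
`θ ∘ S'` were bounded and normal, `(θ ⊗ ι) V* = (θ ∘ S' ⊗ ι) V` would lie in the right leg itself;
functionals with nearly this property are norm dense, as follows.

Put `ω = θ ∘ R` and, for `ε > 0`, let `P = ∫ exp (-s²) ω ∘ τ_{εs} ds` and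
`Q = ∫ exp (-(s + i/(2ε))²) ω ∘ τ_{εs} ds`. Then `P (τ_{-i/2} x) = Q x` on the domain of `τ_{-i/2}`
(`smear_apply_analytic`), whence `(P ∘ R ⊗ ι) V* = (Q ⊗ ι) V`, which is an integral of elements
`(ω ∘ τ_{εs} ⊗ ι) V` of the right leg. As `ε → 0`, `P` converges in norm to a nonzero multiple
of `ω`, and `P ∘ R` to the same multiple of `θ` (`mem_closure_image_of_smear`).

Three facts make this work.
* Automorphisms and anti-automorphisms of `B(H)` are implemented by unitary and antiunitary
  operators, so they preserve the predual (`comp_autCLM_mem_predual`,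
  `IsInvolutiveStarAntiAut.exists_normal`).
* The orbits `t ↦ ω ∘ τ_t` of normal functionals are norm continuous
  (`IsOneParameterGroup.predualSubmodule_le`), so the integrals exist as Bochner integrals.
* A function on a closed strip that is continuous, holomorphic in the interior and zero on one
  boundary line vanishes (`eqOn_zero_of_strip`). No bound at infinity is needed, which matters
  because the definition of the analytic extension requires none.

For the σ-weak closures it remains to note that the adjoint is σ-weakly continuous.
-/

open scoped Topology

noncomputable section

namespace MultUnitary

open Filter InnerProductSpace MeasureTheory

/-! ### Normal functionals -/

section Normal

/-- An absolutely convergent series of functionals that converges pointwise to `ω` converges to `ω`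
in norm. -/
theorem mem_of_hasSum_apply {B : Type*} [NormedAddCommGroup B] [NormedSpace ℂ B]
    {C : Submodule ℂ (StrongDual ℂ B)} (hC : IsClosed (C : Set (StrongDual ℂ B)))
    {f : ℕ → StrongDual ℂ B} (hf : ∀ n, f n ∈ C) (hs : Summable fun n => ‖f n‖)
    {ω : StrongDual ℂ B} (hω : ∀ x, HasSum (fun n => f n x) (ω x)) : ω ∈ C := by
  have e : ω = ∑' n, f n := ContinuousLinearMap.ext fun x =>
    (hω x).unique ((ContinuousLinearMap.apply ℂ ℂ x).hasSum hs.of_norm.hasSum)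
  rw [e]
  exact hC.mem_of_tendsto hs.of_norm.hasSum
    (Eventually.of_forall fun s => C.sum_mem fun n _ => hf n)

variable {H : Type*} [NormedAddCommGroup H] [InnerProductSpace ℂ H]

/-- The vector functional `T ↦ ⟪η, T ξ⟫`. -/
def vectorFunctional (ξ η : H) : StrongDual ℂ (H →L[ℂ] H) :=
  innerSL ℂ η ∘L ContinuousLinearMap.apply ℂ H ξ

theorem vectorFunctional_apply (ξ η : H) (T : H →L[ℂ] H) :
    vectorFunctional ξ η T = ⟪η, T ξ⟫_ℂ := rfl

theorem norm_vectorFunctional_le (ξ η : H) : ‖vectorFunctional ξ η‖ ≤ ‖ξ‖ * ‖η‖ :=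
  ContinuousLinearMap.opNorm_le_bound _ (by positivity) fun T => by
    rw [vectorFunctional_apply]
    calc ‖⟪η, T ξ⟫_ℂ‖ ≤ ‖η‖ * ‖T ξ‖ := norm_inner_le_norm _ _
      _ ≤ ‖η‖ * (‖T‖ * ‖ξ‖) := by gcongr; exact T.le_opNorm ξ
      _ = ‖ξ‖ * ‖η‖ * ‖T‖ := by ring

theorem vectorFunctional_mem_predual (ξ η : H) : vectorFunctional ξ η ∈ predual H := by
  refine ⟨Pi.single 0 ξ, Pi.single 0 η, ?_, ?_, fun x => ?_⟩
  · refine summable_of_ne_finset_zero (s := {0}) fun n hn => ?_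
    simp [Pi.single_eq_of_ne (Finset.notMem_singleton.1 hn)]
  · refine summable_of_ne_finset_zero (s := {0}) fun n hn => ?_
    simp [Pi.single_eq_of_ne (Finset.notMem_singleton.1 hn)]
  · have h := hasSum_single (f := fun n : ℕ => ⟪(Pi.single 0 η : ℕ → H) n,
      x ((Pi.single 0 ξ : ℕ → H) n)⟫_ℂ) 0 fun n hn => by simp [Pi.single_eq_of_ne hn]
    simpa [vectorFunctional_apply] using h

theorem add_mem_predual {ω ω' : StrongDual ℂ (H →L[ℂ] H)} (h : ω ∈ predual H)
    (h' : ω' ∈ predual H) : ω + ω' ∈ predual H := by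
  obtain ⟨ξ, η, hξ, hη, hω⟩ := h
  obtain ⟨ξ', η', hξ', hη', hω'⟩ := h'
  -- the two series are interleaved
  refine ⟨fun n => if Even n then ξ (n / 2) else ξ' (n / 2),
    fun n => if Even n then η (n / 2) else η' (n / 2), ?_, ?_, fun x => ?_⟩
  · refine Summable.even_add_odd ?_ ?_
    · simpa using hξ
    · simpa [Nat.mul_add_div] using hξ'
  · refine Summable.even_add_odd ?_ ?_
    · simpa using hη
    · simpa [Nat.mul_add_div] using hη'
  · refine HasSum.even_add_odd ?_ ?_
    · simpa using hω x
    · simpa [Nat.mul_add_div] using hω' x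

variable (H) in
/-- The predual of `B(H)` as a subspace of the norm dual. -/
def predualSubmodule : Submodule ℂ (StrongDual ℂ (H →L[ℂ] H)) where
  carrier := predual H
  add_mem' := add_mem_predual
  zero_mem' := ⟨0, 0, by simp [summable_zero], by simp [summable_zero],
    fun x => by simp [hasSum_zero]⟩
  smul_mem' := by
    rintro c ω ⟨ξ, η, hξ, hη, hω⟩
    refine ⟨fun n => c • ξ n, η, ?_, hη, fun x => ?_⟩
    · simpa [norm_smul, mul_pow] using hξ.mul_left (‖c‖ ^ 2)
    · simpa [inner_smul_right] using (hω x).mul_left c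

theorem vectorFunctional_polarization (ξ η : H) :
    vectorFunctional ξ η = (1 / 4 : ℂ) •
      (vectorFunctional (ξ + η) (ξ + η) - vectorFunctional (ξ - η) (ξ - η)
        + Complex.I • vectorFunctional (ξ + Complex.I • η) (ξ + Complex.I • η)
        - Complex.I • vectorFunctional (ξ - Complex.I • η) (ξ - Complex.I • η)) := by
  ext T
  simp only [smul_apply, add_apply, sub_apply, vectorFunctional_apply, map_add, map_sub,
    map_smul, inner_add_left, inner_add_right, inner_sub_left, inner_sub_right,
    inner_smul_left, inner_smul_right, Complex.conj_I, smul_eq_mul]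
  ring_nf
  simp only [Complex.I_sq]
  ring

/-- A normal functional is a norm convergent sum of vector functionals, and by polarization the
functionals `⟪ζ, · ζ⟫` span the vector functionals. -/
theorem predual_subset_of_vectorFunctional_mem
    {C : Submodule ℂ (StrongDual ℂ (H →L[ℂ] H))}
    (hC : IsClosed (C : Set (StrongDual ℂ (H →L[ℂ] H))))
    (h : ∀ ζ : H, vectorFunctional ζ ζ ∈ C) : predual H ⊆ C := by
  have hpol : ∀ ξ η : H, vectorFunctional ξ η ∈ C := fun ξ η => by
    rw [vectorFunctional_polarization]
    exact C.smul_mem _ (C.sub_mem (C.add_mem (C.sub_mem (h _) (h _)) (C.smul_mem _ (h _)))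
      (C.smul_mem _ (h _)))
  rintro ω ⟨ξ, η, hξ, hη, hω⟩
  refine mem_of_hasSum_apply hC (fun n => hpol (ξ n) (η n)) ?_ hω
  refine Summable.of_nonneg_of_le (fun n => norm_nonneg (vectorFunctional (ξ n) (η n)))
    (fun n => (norm_vectorFunctional_le _ _).trans ?_) (hξ.add hη)
  nlinarith [sq_nonneg (‖ξ n‖ - ‖η n‖), sq_nonneg ‖ξ n‖, sq_nonneg ‖η n‖]

variable [CompleteSpace H]

/-- The functional `x ↦ conj (ω (x*))` is normal when `ω` is. -/
theorem exists_conj_mem_predual {ω : StrongDual ℂ (H →L[ℂ] H)} (h : ω ∈ predual H) :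
    ∃ ω' ∈ predual H, ∀ x, ω' x = conj (ω (star x)) := by
  let ω' : StrongDual ℂ (H →L[ℂ] H) := LinearMap.mkContinuous
    { toFun := fun x => conj (ω (star x))
      map_add' := fun x y => by simp
      map_smul' := fun c x => by simp [star_smul] } ‖ω‖ fun x => by
        simpa using ω.le_opNorm (star x)
  have hω' : ∀ x, ω' x = conj (ω (star x)) := fun x => rfl
  refine ⟨ω', ?_, hω'⟩
  obtain ⟨ξ, η, hξ, hη, hω⟩ := h
  refine ⟨η, ξ, hη, hξ, fun x => ?_⟩
  rw [hω']
  simpa [Function.comp_def, ContinuousLinearMap.star_eq_adjoint,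
    ContinuousLinearMap.adjoint_inner_right] using
    (hω (star x)).map (starRingEnd ℂ) Complex.continuous_conj

end Normal

/-! ### Normality of automorphisms and anti-automorphisms -/

section Normality

variable {H : Type*} [NormedAddCommGroup H] [InnerProductSpace ℂ H] [CompleteSpace H]

/-- A `*`-automorphism of `B(H)` as a bounded linear map. -/
def autCLM (τ : (H →L[ℂ] H) ≃⋆ₐ[ℂ] (H →L[ℂ] H)) : (H →L[ℂ] H) →L[ℂ] (H →L[ℂ] H) :=
  LinearMap.mkContinuous
    { toFun := τ, map_add' := map_add τ, map_smul' := map_smul τ } 1 fun x => by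
      simpa using (StarAlgEquiv.norm_map τ x).le

theorem autCLM_apply (τ : (H →L[ℂ] H) ≃⋆ₐ[ℂ] (H →L[ℂ] H)) (x : H →L[ℂ] H) :
    autCLM τ x = τ x := rfl

theorem norm_autCLM_le (τ : (H →L[ℂ] H) ≃⋆ₐ[ℂ] (H →L[ℂ] H)) : ‖autCLM τ‖ ≤ 1 :=
  LinearMap.mkContinuous_norm_le _ zero_le_one _

/-- A `*`-automorphism of `B(H)` is implemented by a unitary. -/
theorem exists_unitary_implementing (τ : (H →L[ℂ] H) ≃⋆ₐ[ℂ] (H →L[ℂ] H)) :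
    ∃ U : H ≃ₗᵢ[ℂ] H, ∀ (x : H →L[ℂ] H) (ξ η : H),
      ⟪η, τ x ξ⟫_ℂ = ⟪U.symm η, x (U.symm ξ)⟫_ℂ := by
  obtain ⟨U, hU⟩ := τ.eq_linearIsometryEquivConjStarAlgEquiv (StarAlgEquiv.isometry τ).continuous
  refine ⟨U, fun x ξ η => ?_⟩
  rw [hU, LinearIsometryEquiv.conjStarAlgEquiv_apply_apply, ← U.symm.inner_map_map,
    U.symm_apply_apply]

theorem comp_autCLM_mem_predual (τ : (H →L[ℂ] H) ≃⋆ₐ[ℂ] (H →L[ℂ] H))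
    {ω : StrongDual ℂ (H →L[ℂ] H)} (h : ω ∈ predual H) : ω ∘L autCLM τ ∈ predual H := by
  obtain ⟨U, hU⟩ := exists_unitary_implementing τ
  obtain ⟨ξ, η, hξ, hη, hω⟩ := h
  refine ⟨fun n => U.symm (ξ n), fun n => U.symm (η n), by simpa using hξ, by simpa using hη,
    fun x => ?_⟩
  simp only [← hU]
  exact hω (τ x)

/-- An involutive `*`-anti-automorphism of `B(H)` is implemented by an antiunitary operator. -/
theorem IsInvolutiveStarAntiAut.exists_antiunitary {R : (H →L[ℂ] H) →ₗ[ℂ] (H →L[ℂ] H)}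
    (hR : IsInvolutiveStarAntiAut R) :
    ∃ J : H → H, Function.Surjective J ∧ (∀ x y, ⟪J x, J y⟫_ℂ = ⟪y, x⟫_ℂ) ∧
      ∀ T x, R T (J x) = J (star T x) := by
  rcases subsingleton_or_nontrivial H with hH | hH
  · exact ⟨id, Function.surjective_id, fun x y => by rw [Subsingleton.elim x y]; rfl,
      fun T x => Subsingleton.elim _ _⟩
  have hinj : Function.Injective R := Function.LeftInverse.injective hR.involutive
  obtain ⟨e, he⟩ := exists_norm_eq H (zero_le_one (α := ℝ))
  -- `f` is a unit vector in the range of the projection `R |e⟩⟨e|`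
  obtain ⟨f, hf, hf'⟩ : ∃ f : H, ‖f‖ = 1 ∧ R (rankOne ℂ e e) f = f := by
    have hne : R (rankOne ℂ e e) ≠ 0 := by
      rw [← map_zero R, hinj.ne_iff]
      have he0 : e ≠ 0 := norm_ne_zero_iff.1 (by simp [he])
      exact rankOne_ne_zero he0 he0
    obtain ⟨g, hg⟩ : ∃ g, R (rankOne ℂ e e) g ≠ 0 := by
      by_contra! h
      exact hne (ContinuousLinearMap.ext h)
    refine ⟨((‖R (rankOne ℂ e e) g‖⁻¹ : ℝ) : ℂ) • R (rankOne ℂ e e) g, ?_, ?_⟩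
    · simp [norm_smul, hg]
    · rw [map_smul, ← mul_apply_eq_comp, ← hR.map_mul]
      rw [(isIdempotentElem_rankOne_self he).eq]
  have hstar : ∀ x y : H, star (rankOne ℂ x y : H →L[ℂ] H) = rankOne ℂ y x := fun x y => by
    rw [ContinuousLinearMap.star_eq_adjoint, adjoint_rankOne]
  have hmul : ∀ x y z w : H,
      (rankOne ℂ x y : H →L[ℂ] H) * rankOne ℂ z w = ⟪y, z⟫_ℂ • rankOne ℂ x w :=
    fun x y z w => rankOne_comp_rankOne x y z w
  have hT : ∀ (T : H →L[ℂ] H) x, R T (R (rankOne ℂ e x) f) = R (rankOne ℂ e (star T x)) f :=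
    fun T x => by
      rw [← mul_apply_eq_comp, ← hR.map_mul]
      congr 2
      ext z
      simp [ContinuousLinearMap.star_eq_adjoint, ContinuousLinearMap.adjoint_inner_left]
  refine ⟨fun x => R (rankOne ℂ e x) f, fun g => ?_, fun x y => ?_, hT⟩
  · -- `|g⟩⟨f|` is `R T` for some `T`, and maps `f` to `g`
    refine ⟨star (R (rankOne ℂ g f)) e, ?_⟩
    change R (rankOne ℂ e (star (R (rankOne ℂ g f)) e)) f = g
    rw [← hT, hf', hR.involutive]
    simp [hf]
  · rw [← ContinuousLinearMap.adjoint_inner_right, ← ContinuousLinearMap.star_eq_adjoint,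
      ← hR.map_star, hstar, ← mul_apply_eq_comp, ← hR.map_mul, hmul, map_smul,
      smul_apply, hf', inner_smul_right, inner_self_eq_norm_sq_to_K, hf]
    simp

/-- An involutive `*`-anti-automorphism of `B(H)` is bounded and normal. -/
theorem IsInvolutiveStarAntiAut.exists_normal {R : (H →L[ℂ] H) →ₗ[ℂ] (H →L[ℂ] H)}
    (hR : IsInvolutiveStarAntiAut R) :
    ∃ R' : (H →L[ℂ] H) →L[ℂ] (H →L[ℂ] H), (∀ x, R' x = R x) ∧
      ∀ ω ∈ predual H, ω ∘L R' ∈ predual H := by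
  obtain ⟨J, hJ, hinner, hRJ⟩ := hR.exists_antiunitary
  have hnorm : ∀ x, ‖J x‖ = ‖x‖ := fun x => by
    rw [@norm_eq_sqrt_re_inner ℂ, @norm_eq_sqrt_re_inner ℂ, hinner]
  obtain ⟨K, hK⟩ := hJ.hasRightInverse
  have hKn : ∀ x, ‖K x‖ = ‖x‖ := fun x => by rw [← hnorm, hK]
  refine ⟨R.mkContinuous 1 fun T => ?_, fun x => rfl, ?_⟩
  · refine ContinuousLinearMap.opNorm_le_bound _ (by positivity) fun x => ?_
    rw [← hK x, hRJ, hnorm, hnorm, one_mul, ← norm_star T]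
    exact (star T).le_opNorm _
  · rintro ω ⟨ξ, η, hξ, hη, hω⟩
    refine ⟨fun n => K (η n), fun n => K (ξ n), by simpa only [hKn] using hη,
      by simpa only [hKn] using hξ, fun x => ?_⟩
    have h := hω (R x)
    refine h.congr_fun fun n => ?_
    conv_rhs => rw [← hK (ξ n), ← hK (η n), hRJ, hinner, ContinuousLinearMap.star_eq_adjoint,
      ContinuousLinearMap.adjoint_inner_left]

end Normality

/-! ### Holomorphic functions on a horizontal strip -/

section Strip

variable {a : ℝ} {f : ℂ → ℂ}

/-- If `f` vanishes on one side of a square, the product of its four rotates about the centre of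
the square vanishes on the whole boundary, so `f` vanishes at the centre by the maximum modulus
principle. -/
theorem eq_zero_at_center_of_strip {r s : ℝ} (hr : 0 < r) (hra : 2 * r ≤ a)
    (hc : ContinuousOn f {z : ℂ | z.im ∈ Set.Icc (-a) 0})
    (hd : DifferentiableOn ℂ f {z : ℂ | z.im ∈ Set.Ioo (-a) 0})
    (h0 : ∀ t : ℝ, f t = 0) : f (s - r * Complex.I) = 0 := by
  set c : ℂ := s - r * Complex.I with hcdef
  have hcim : c.im = -r := by simp [hcdef]
  let U : Set ℂ := Set.Ioo (-r) r ×ℂ Set.Ioo (-r) r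
  have hcl : closure U = Set.Icc (-r) r ×ℂ Set.Icc (-r) r := by
    rw [Complex.closure_reProdIm, closure_Ioo (by linarith)]
  have hUb : Bornology.IsBounded U :=
    (Metric.isBounded_Ioo _ _).reProdIm (Metric.isBounded_Ioo _ _)
  let rot : Fin 4 → ℂ → ℂ := fun j w => c + (![1, Complex.I, -1, -Complex.I] : Fin 4 → ℂ) j * w
  have hrotd : ∀ j, Differentiable ℂ (rot j) := fun j => by fun_prop
  have hmapo : ∀ j, Set.MapsTo (rot j) U {z : ℂ | z.im ∈ Set.Ioo (-a) 0} := by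
    rintro j w ⟨⟨h1, h2⟩, h3, h4⟩
    fin_cases j <;> simp [rot, hcim] <;> constructor <;> linarith
  have hmapc : ∀ j, Set.MapsTo (rot j) (closure U) {z : ℂ | z.im ∈ Set.Icc (-a) 0} := by
    rw [hcl]
    rintro j w ⟨⟨h1, h2⟩, h3, h4⟩
    fin_cases j <;> simp [rot, hcim] <;> constructor <;> linarith
  let p : ℂ → ℂ := fun w => ∏ j, f (rot j w)
  have hp : DiffContOnCl ℂ p U := by
    refine ⟨?_, ?_⟩
    · exact DifferentiableOn.fun_finsetProd fun j _ =>
        hd.comp (hrotd j).differentiableOn (hmapo j)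
    · exact continuousOn_finsetProd _ fun j _ =>
        hc.comp (hrotd j).continuous.continuousOn (hmapc j)
  have hreal : ∀ z : ℂ, z.im = 0 → f z = 0 := fun z hz => by
    rw [← h0 z.re]; congr 1; exact Complex.ext (by simp) (by simp [hz])
  have hfr : ∀ w ∈ frontier U, ‖p w‖ ≤ 0 := by
    intro w hw
    rw [norm_le_zero_iff]
    suffices h : ∃ j, (rot j w).im = 0 by
      obtain ⟨j, hj⟩ := h
      exact Finset.prod_eq_zero (Finset.mem_univ j) (hreal _ hj)
    rw [Complex.frontier_reProdIm, frontier_Ioo (by linarith)] at hw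
    rcases hw with ⟨-, h | h⟩ | ⟨h | h, -⟩
    · exact ⟨2, by simp_all [rot]⟩
    · exact ⟨0, by simp_all [rot]⟩
    · exact ⟨3, by simp_all [rot]⟩
    · exact ⟨1, by simp_all [rot]⟩
  have h00 : (0 : ℂ) ∈ closure U := by
    rw [hcl]
    constructor <;> simp [hr.le]
  have := norm_le_zero_iff.1 (Complex.norm_le_of_forall_mem_frontier_norm_le hUb hp hfr h00)
  simpa [p, rot, Fin.prod_univ_four] using this

/-- The Schwarz reflection principle would give this; here the centres of squares with one side on
the real line fill half of the strip, and the identity theorem does the rest. -/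
theorem eqOn_zero_of_strip (ha : 0 < a)
    (hc : ContinuousOn f {z : ℂ | z.im ∈ Set.Icc (-a) 0})
    (hd : DifferentiableOn ℂ f {z : ℂ | z.im ∈ Set.Ioo (-a) 0})
    (h0 : ∀ t : ℝ, f t = 0) : Set.EqOn f 0 {z : ℂ | z.im ∈ Set.Icc (-a) 0} := by
  have hopen : IsOpen {z : ℂ | z.im ∈ Set.Ioo (-a) 0} := isOpen_Ioo.preimage Complex.continuous_im
  have hconv : Convex ℝ {z : ℂ | z.im ∈ Set.Ioo (-a) 0} :=
    (convex_Ioo (-a) 0).linear_preimage Complex.imLm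
  have hupper : ∀ z : ℂ, z.im ∈ Set.Ioo (-(a / 2)) 0 → f z = 0 := fun z hz => by
    have h := eq_zero_at_center_of_strip (r := -z.im) (s := z.re) (by linarith [hz.2])
      (by linarith [hz.1]) hc hd h0
    rw [← h]; congr 1; exact Complex.ext (by simp) (by simp)
  have hz0 : ((-(a / 4) : ℝ) * Complex.I : ℂ).im = -(a / 4) := by simp
  have hint : Set.EqOn f 0 {z : ℂ | z.im ∈ Set.Ioo (-a) 0} := by
    refine (hd.analyticOnNhd hopen).eqOn_zero_of_preconnected_of_eventuallyEq_zero
      hconv.isPreconnected (z₀ := (-(a / 4) : ℝ) * Complex.I) ?_ ?_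
    · rw [Set.mem_ofPred_eq, hz0]
      constructor <;> linarith
    · filter_upwards [((isOpen_Ioo (a := -(a / 2)) (b := 0)).preimage
        Complex.continuous_im).mem_nhds
          (show ((-(a / 4) : ℝ) * Complex.I : ℂ) ∈ Complex.im ⁻¹' Set.Ioo (-(a / 2)) 0 by
          rw [Set.mem_preimage, hz0]; constructor <;> linarith)] with z hz
      exact hupper z hz
  refine hint.of_subset_closure hc continuousOn_const
    (fun z hz => Set.Ioo_subset_Icc_self hz) ?_
  change _ ⊆ closure (Complex.im ⁻¹' Set.Ioo (-a) 0)
  rw [Complex.closure_preimage_im, closure_Ioo (by linarith)]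
  exact subset_rfl

end Strip

/-! ### Weak holomorphy -/

section Limits

variable {B : Type*} [NormedAddCommGroup B] [NormedSpace ℂ B]

/-- For a locally bounded function `F`, the functionals `ω` for which `ω ∘ F` is continuous on `S`
and holomorphic on an open set `U` form a norm closed set. -/
theorem continuousOn_and_differentiableOn_of_mem_closure {F : ℂ → B} {S U : Set ℂ} (hU : IsOpen U)
    (hUS : U ⊆ S) (hF : ∀ r : ℝ, ∃ C : ℝ, ∀ z ∈ S, ‖z‖ ≤ r → ‖F z‖ ≤ C)
    {N : Set (StrongDual ℂ B)}
    (hN : ∀ ω ∈ N, ContinuousOn (fun z => ω (F z)) S ∧ DifferentiableOn ℂ (fun z => ω (F z)) U)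
    {ω : StrongDual ℂ B} (hω : ω ∈ closure N) :
    ContinuousOn (fun z => ω (F z)) S ∧ DifferentiableOn ℂ (fun z => ω (F z)) U := by
  obtain ⟨u, huN, hu⟩ := mem_closure_iff_seq_limit.1 hω
  have key : TendstoLocallyUniformlyOn (fun n z => u n (F z)) (fun z => ω (F z)) atTop S := by
    rw [Metric.tendstoLocallyUniformlyOn_iff]
    intro ε hε z hz
    obtain ⟨C, hC⟩ := hF (‖z‖ + 1)
    refine ⟨S ∩ Metric.ball z 1, inter_mem_nhdsWithin _ (Metric.ball_mem_nhds z one_pos), ?_⟩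
    have hlim : Tendsto (fun n => ‖u n - ω‖ * |C|) atTop (𝓝 0) := by
      simpa using (tendsto_iff_norm_sub_tendsto_zero.1 hu).mul_const |C|
    filter_upwards [hlim.eventually (gt_mem_nhds hε)] with n hn w hw
    rw [dist_comm, dist_eq_norm, ← _root_.sub_apply]
    refine ((u n - ω).le_opNorm _).trans_lt (lt_of_le_of_lt ?_ hn)
    gcongr
    refine (hC w hw.1 ?_).trans (le_abs_self C)
    have h1 := hw.2
    rw [Metric.mem_ball, dist_eq_norm] at h1
    calc ‖w‖ = ‖z + (w - z)‖ := by congr 1; ring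
      _ ≤ ‖z‖ + ‖w - z‖ := norm_add_le _ _
      _ ≤ ‖z‖ + 1 := by gcongr
  exact ⟨key.continuousOn (Frequently.of_forall fun n => (hN _ (huN n)).1),
    (key.mono hUS).differentiableOn (Eventually.of_forall fun n => (hN _ (huN n)).2) hU⟩

theorem integral_mem_of_isClosed [CompleteSpace B] {K : Submodule ℂ B} (hK : IsClosed (K : Set B))
    {X : Type*} [MeasurableSpace X] {μ : Measure X} {f : X → B} (hf : ∀ x, f x ∈ K) :
    ∫ x, f x ∂μ ∈ K := by
  by_cases hi : Integrable f μ
  · have := hK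
    have h := K.mkQL.integral_comp_comm hi
    have h0 : ∀ x, K.mkQL (f x) = 0 := fun x => (Submodule.Quotient.mk_eq_zero K).2 (hf x)
    simp only [h0, integral_zero] at h
    exact (Submodule.Quotient.mk_eq_zero K).1 h.symm
  · rw [integral_undef hi]
    exact K.zero_mem

end Limits

/-! ### Gaussian smearing -/

section Gaussian

variable {E : Type*} [NormedAddCommGroup E] [NormedSpace ℂ E]

/-- The Gaussian weight `s ↦ exp (-(s - w) ^ 2)` with a complex centre `w`. -/
def gauss (w : ℂ) (s : ℝ) : ℂ := Complex.exp (-(s - w) ^ 2)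

/-- A Gaussian bound that is uniform for centres in a disc. -/
theorem norm_gauss_le {w : ℂ} {M : ℝ} (hw : ‖w‖ ≤ M) (s : ℝ) :
    ‖gauss w s‖ ≤ Real.exp (2 * M ^ 2) * Real.exp (-(1 / 2) * s ^ 2) := by
  rw [gauss, Complex.norm_exp, ← Real.exp_add, Real.exp_le_exp]
  have h1 : (-((s : ℂ) - w) ^ 2).re = -(s - w.re) ^ 2 + w.im ^ 2 := by
    simp [sq]; ring
  have h2 : w.re ^ 2 + w.im ^ 2 ≤ M ^ 2 := by
    have : w.re ^ 2 + w.im ^ 2 = ‖w‖ ^ 2 := by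
      rw [Complex.sq_norm, Complex.normSq_apply]; ring
    rw [this]
    gcongr
  rw [h1]
  nlinarith [sq_nonneg (s - 2 * w.re), sq_nonneg w.re, sq_nonneg w.im]

theorem continuous_gauss (w : ℂ) : Continuous (gauss w) := by
  unfold gauss; fun_prop

theorem integrable_gauss_smul (w : ℂ) {f : ℝ → E} (hf : Continuous f) {C : ℝ}
    (hC : ∀ s, ‖f s‖ ≤ C) : Integrable fun s => gauss w s • f s := by
  refine Integrable.mono' (((integrable_exp_neg_mul_sq (b := 1 / 2) (by norm_num)).const_mul
    (Real.exp (2 * ‖w‖ ^ 2))).mul_const C) ((continuous_gauss w).smul hf).aestronglyMeasurable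
    (Eventually.of_forall fun s => ?_)
  rw [norm_smul]
  exact mul_le_mul (norm_gauss_le le_rfl s) (hC s) (norm_nonneg _) (by positivity)

theorem differentiable_integral_gauss {g : ℝ → ℂ} (hg : Continuous g) {C : ℝ}
    (hC : ∀ s, ‖g s‖ ≤ C) : Differentiable ℂ fun w => ∫ s, gauss w s • g s := by
  intro w₀
  have hC0 : 0 ≤ C := (norm_nonneg _).trans (hC 0)
  have hderiv : ∀ (s : ℝ) (w : ℂ), HasDerivAt (fun w => gauss w s • g s)
      ((gauss w s * (2 * (s - w))) • g s) w := fun s w => by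
    have h1 : HasDerivAt (fun w : ℂ => -((s : ℂ) - w) ^ 2) (2 * (s - w)) w := by
      have := (((hasDerivAt_id w).const_sub (s : ℂ)).fun_pow 2).fun_neg
      convert! this using 1
      simp
    exact (h1.cexp).smul_const (g s)
  set M : ℝ := ‖w₀‖ + 1
  have key := hasDerivAt_integral_of_dominated_loc_of_deriv_le (μ := volume)
    (F := fun w s => gauss w s • g s) (F' := fun w s => (gauss w s * (2 * (s - w))) • g s)
    (x₀ := w₀) (s := Metric.ball w₀ 1)
    (bound := fun s => Real.exp (2 * M ^ 2) * (2 * C) *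
      (|s * Real.exp (-(1 / 2) * s ^ 2)| + M * Real.exp (-(1 / 2) * s ^ 2)))
    (Metric.ball_mem_nhds w₀ one_pos)
    (Eventually.of_forall fun w => ((continuous_gauss w).smul hg).aestronglyMeasurable)
    (integrable_gauss_smul w₀ hg hC)
    (Continuous.aestronglyMeasurable (by have := continuous_gauss w₀; fun_prop))
    (Eventually.of_forall fun s w hw => ?_) ?_
    (Eventually.of_forall fun s w _ => hderiv s w)
  · exact key.2.differentiableAt
  · have hwM : ‖w‖ ≤ M := by
      rw [Metric.mem_ball, dist_eq_norm] at hw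
      calc ‖w‖ = ‖w₀ + (w - w₀)‖ := by congr 1; ring
        _ ≤ ‖w₀‖ + ‖w - w₀‖ := norm_add_le _ _
        _ ≤ M := by simp only [M]; gcongr
    have h1 : ‖(2 * ((s : ℂ) - w))‖ ≤ 2 * (|s| + M) := by
      rw [norm_mul, Complex.norm_ofNat]
      gcongr
      refine (norm_sub_le _ _).trans ?_
      rw [Complex.norm_real, Real.norm_eq_abs]
      gcongr
    rw [norm_smul, norm_mul, abs_mul, Real.abs_exp]
    calc ‖gauss w s‖ * ‖2 * ((s : ℂ) - w)‖ * ‖g s‖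
        ≤ (Real.exp (2 * M ^ 2) * Real.exp (-(1 / 2) * s ^ 2)) * (2 * (|s| + M)) * C := by
          gcongr
          · exact norm_gauss_le hwM s
          · exact hC s
      _ = _ := by ring
  · exact (((integrable_mul_exp_neg_mul_sq (b := 1 / 2) (by norm_num)).abs).add
      ((integrable_exp_neg_mul_sq (b := 1 / 2) (by norm_num)).const_mul M)).const_mul _

theorem integral_gauss_zero_ne_zero : ∫ s, gauss 0 s ≠ 0 := by
  have h : ∀ s : ℝ, gauss 0 s = ((Real.exp (-1 * s ^ 2) : ℝ) : ℂ) := fun s => by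
    simp [gauss]
  simp only [h]
  rw [integral_complex_ofReal, integral_gaussian]
  simp
  exact (Real.sqrt_pos.2 Real.pi_pos).ne'

/-- The Gaussian averages of `f` at scale `ε` converge to a multiple of `f 0` as `ε → 0`. -/
theorem tendsto_integral_gauss_zero [CompleteSpace E] {f : ℝ → E} (hf : Continuous f) {C : ℝ}
    (hC : ∀ s, ‖f s‖ ≤ C) :
    Tendsto (fun ε : ℝ => ∫ s, gauss 0 s • f (ε * s)) (𝓝[>] 0) (𝓝 ((∫ s, gauss 0 s) • f 0)) := by
  have hC0 : 0 ≤ C := (norm_nonneg _).trans (hC 0)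
  rw [← integral_smul_const]
  refine tendsto_integral_filter_of_dominated_convergence
    (fun s => Real.exp (2 * 0 ^ 2) * Real.exp (-(1 / 2) * s ^ 2) * C)
    (Eventually.of_forall fun ε => ((continuous_gauss 0).smul
      (by fun_prop)).aestronglyMeasurable)
    (Eventually.of_forall fun ε => Eventually.of_forall fun s => ?_)
    (((integrable_exp_neg_mul_sq (b := 1 / 2) (by norm_num)).const_mul _).mul_const C)
    (Eventually.of_forall fun s => ?_)
  · rw [norm_smul]
    exact mul_le_mul (norm_gauss_le (by simp) s) (hC _) (norm_nonneg _) (by positivity)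
  · have h : Continuous fun ε : ℝ => gauss 0 s • f (ε * s) := by fun_prop
    have := (h.tendsto 0).mono_left (nhdsWithin_le_nhds (s := Set.Ioi 0))
    simpa using this

end Gaussian

/-! ### Smearing functionals along a one-parameter group -/

section Smearing

variable {B : Type*} [NormedAddCommGroup B] [NormedSpace ℂ B] {τ : ℝ → B →L[ℂ] B}

theorem norm_comp_le_of_contraction (hτ : ∀ t, ‖τ t‖ ≤ 1) (ω : StrongDual ℂ B) (t : ℝ) :
    ‖ω ∘L τ t‖ ≤ ‖ω‖ :=
  (ω.opNorm_comp_le (τ t)).trans (mul_le_of_le_one_right (norm_nonneg _) (hτ t))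

/-- The functionals whose orbit under `τ` is norm continuous. -/
def normContinuousFunctionals (τ : ℝ → B →L[ℂ] B) : Submodule ℂ (StrongDual ℂ B) where
  carrier := {ω | Continuous fun t => ω ∘L τ t}
  add_mem' h h' := by
    simpa only [Set.mem_ofPred_eq, ContinuousLinearMap.add_comp] using! h.add h'
  zero_mem' := by simpa using! continuous_const
  smul_mem' c ω h := by
    simpa only [Set.mem_ofPred_eq, ContinuousLinearMap.smul_comp] using! h.const_smul c

theorem isClosed_normContinuousFunctionals (hτ : ∀ t, ‖τ t‖ ≤ 1) :
    IsClosed (normContinuousFunctionals τ : Set (StrongDual ℂ B)) := by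
  refine isClosed_of_closure_subset fun ω hω => ?_
  obtain ⟨u, huN, hu⟩ := mem_closure_iff_seq_limit.1 hω
  refine TendstoUniformly.continuous (F := fun n t => u n ∘L τ t) (p := atTop) ?_
    (Frequently.of_forall fun n => huN n)
  rw [Metric.tendstoUniformly_iff]
  intro ε hε
  filter_upwards [(tendsto_iff_norm_sub_tendsto_zero.1 hu).eventually (gt_mem_nhds hε)] with n hn t
  rw [dist_comm, dist_eq_norm, ← ContinuousLinearMap.sub_comp]
  exact (norm_comp_le_of_contraction hτ _ t).trans_lt hn

/-- By the group law, norm continuity of an orbit at `0` gives it everywhere. -/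
theorem mem_normContinuousFunctionals_of_tendsto (hadd : ∀ s t, τ (s + t) = τ s ∘L τ t)
    {ω : StrongDual ℂ B} (h : Tendsto (fun t => ω ∘L τ t) (𝓝 0) (𝓝 ω)) :
    ω ∈ normContinuousFunctionals τ := by
  refine continuous_iff_continuousAt.2 fun t₀ => ?_
  have h1 : Tendsto (fun t : ℝ => t - t₀) (𝓝 t₀) (𝓝 0) := by
    simpa using (continuous_sub_right t₀).tendsto t₀
  have h2 := ((continuous_id.clm_comp (continuous_const (y := τ t₀))).tendsto ω).comp (h.comp h1)
  have e : ∀ t, ω ∘L τ t = (ω ∘L τ (t - t₀)) ∘L τ t₀ := fun t => by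
    rw [ContinuousLinearMap.comp_assoc, ← hadd, sub_add_cancel]
  exact Tendsto.congr (fun t => (e t).symm) h2

/-- The Gaussian average `∫ exp (-(s - w) ^ 2) ω ∘ τ (ε s) ds` of the orbit of `ω`. -/
def smear (τ : ℝ → B →L[ℂ] B) (ε : ℝ) (w : ℂ) (ω : StrongDual ℂ B) : StrongDual ℂ B :=
  ∫ s, gauss w s • (ω ∘L τ (ε * s))

theorem smear_apply (hτ : ∀ t, ‖τ t‖ ≤ 1) {ω : StrongDual ℂ B}
    (hω : ω ∈ normContinuousFunctionals τ) (ε : ℝ) (w : ℂ) (x : B) :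
    smear τ ε w ω x = ∫ s, gauss w s • ω (τ (ε * s) x) := by
  have hω' : Continuous fun t => ω ∘L τ t := hω
  rw [smear, ContinuousLinearMap.integral_apply (integrable_gauss_smul w
    (f := fun s => ω ∘L τ (ε * s)) (hω'.comp (continuous_const_mul ε))
    fun s => norm_comp_le_of_contraction hτ ω _)]
  rfl

theorem tendsto_smear (hτ : ∀ t, ‖τ t‖ ≤ 1) (h0 : τ 0 = ContinuousLinearMap.id ℂ B)
    {ω : StrongDual ℂ B} (hω : ω ∈ normContinuousFunctionals τ) :
    Tendsto (fun ε => smear τ ε 0 ω) (𝓝[>] 0) (𝓝 ((∫ s, gauss 0 s) • ω)) := by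
  have hω' : Continuous fun t => ω ∘L τ t := hω
  have h := tendsto_integral_gauss_zero hω' fun t => norm_comp_le_of_contraction hτ ω t
  rwa [h0, ContinuousLinearMap.comp_id] at h

/-- A smeared functional moves the analytic extension onto the Gaussian: the functions
`z ↦ (smear τ ε 0 ω) (F z)` and `z ↦ ∫ exp (-(s - z / ε) ^ 2) ω (τ (ε s) x) ds` agree on the real
line, hence on the strip. -/
theorem smear_apply_analytic (hτ : ∀ t, ‖τ t‖ ≤ 1) (hadd : ∀ s t, τ (s + t) = τ s ∘L τ t)
    {C : Submodule ℂ (StrongDual ℂ B)} (hCinv : ∀ ω ∈ C, ∀ t, ω ∘L τ t ∈ C)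
    {a : ℝ} (ha : 0 < a) {F : ℂ → B} {x : B} (hFx : ∀ t : ℝ, F t = τ t x)
    (hFb : ∀ r : ℝ, ∃ M : ℝ, ∀ z ∈ {z : ℂ | z.im ∈ Set.Icc (-a) 0}, ‖z‖ ≤ r → ‖F z‖ ≤ M)
    (hF : ∀ ω ∈ C, ContinuousOn (fun z => ω (F z)) {z : ℂ | z.im ∈ Set.Icc (-a) 0} ∧
      DifferentiableOn ℂ (fun z => ω (F z)) {z : ℂ | z.im ∈ Set.Ioo (-a) 0})
    {ω : StrongDual ℂ B} (hωC : ω ∈ C) (hω : ω ∈ normContinuousFunctionals τ)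
    {ε : ℝ} (hε : 0 < ε) {z : ℂ} (hz : z.im ∈ Set.Icc (-a) 0) :
    smear τ ε 0 ω (F z) = smear τ ε (z / ε) ω x := by
  have hω' : Continuous fun t => ω ∘L τ t := hω
  have hopen : IsOpen {z : ℂ | z.im ∈ Set.Ioo (-a) 0} := isOpen_Ioo.preimage Complex.continuous_im
  have hPC : smear τ ε 0 ω ∈ C.topologicalClosure :=
    integral_mem_of_isClosed C.isClosed_topologicalClosure fun s =>
      C.le_topologicalClosure (C.smul_mem _ (hCinv ω hωC _))
  obtain ⟨hk1, hk2⟩ := continuousOn_and_differentiableOn_of_mem_closure hopen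
    (fun z hz => show z.im ∈ Set.Icc (-a) 0 from Set.Ioo_subset_Icc_self hz) hFb (N := C) hF
    (ω := smear τ ε 0 ω) hPC
  have hg : Continuous fun s : ℝ => ω (τ (ε * s) x) := by
    have h1 : Continuous fun s : ℝ => (ω ∘L τ (ε * s)) x :=
      (hω'.comp (continuous_const.mul continuous_id)).clm_apply continuous_const
    exact h1
  have hgb : ∀ s : ℝ, ‖ω (τ (ε * s) x)‖ ≤ ‖ω‖ * ‖x‖ := fun s =>
    ((ω ∘L τ (ε * s)).le_opNorm x).trans
      (mul_le_mul_of_nonneg_right (norm_comp_le_of_contraction hτ ω _) (norm_nonneg x))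
  have hm : Differentiable ℂ fun z : ℂ => smear τ ε (z / ε) ω x := by
    simp only [smear_apply hτ hω]
    exact (differentiable_integral_gauss hg hgb).comp (differentiable_id.div_const (ε : ℂ))
  have key := eqOn_zero_of_strip ha (f := fun z => smear τ ε 0 ω (F z) - smear τ ε (z / ε) ω x)
    (hk1.sub hm.continuous.continuousOn) (hk2.sub hm.differentiableOn) fun t => ?_
  · exact sub_eq_zero.1 (key hz)
  · rw [sub_eq_zero, smear_apply hτ hω, smear_apply hτ hω, hFx,
      ← integral_sub_right_eq_self (fun s : ℝ => gauss 0 s • ω (τ (ε * s) (τ t x))) (t / ε)]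
    refine integral_congr_ae (Eventually.of_forall fun s => ?_)
    have e : τ (ε * s) x = τ (ε * (s - t / ε)) (τ t x) := by
      rw [← ContinuousLinearMap.comp_apply, ← hadd]
      congr 2
      field_simp
      ring
    simp only [e, gauss]
    push_cast
    rw [sub_zero]

/-- When `τ_w` is the analytic extension, `smear τ ε (w / ε) ω` is `smear τ ε 0 ω ∘ τ_w`, that is,
the functional `smear τ ε 0 ω ∘ R` composed with `R ∘ τ_w`. So `hr` says that, on these functionals,
`r'` is `r` precomposed with the adjoint of `R ∘ τ_w`. Up to scalars they approximate every element
of `C` in norm, and so `r'` maps `C` into the closure of `r '' C`. -/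
theorem mem_closure_image_of_smear {A : Type*} [NormedAddCommGroup A] [NormedSpace ℂ A]
    [CompleteSpace A] (hτ : ∀ t, ‖τ t‖ ≤ 1) (h0 : τ 0 = ContinuousLinearMap.id ℂ B)
    {C : Submodule ℂ (StrongDual ℂ B)} (hCinv : ∀ ω ∈ C, ∀ t, ω ∘L τ t ∈ C)
    (hCcont : C ≤ normContinuousFunctionals τ)
    {R : B →L[ℂ] B} (hRC : ∀ ω ∈ C, ω ∘L R ∈ C) (hRR : R ∘L R = ContinuousLinearMap.id ℂ B)
    {w : ℂ} {r r' : StrongDual ℂ B →L[ℂ] A}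
    (hr : ∀ ω ∈ C, ∀ ε : ℝ, 0 < ε → r' (smear τ ε 0 ω ∘L R) = r (smear τ ε (w / ε) ω))
    {θ : StrongDual ℂ B} (hθ : θ ∈ C) : r' θ ∈ closure (r '' C) := by
  let K : Submodule ℂ A := (C.map (r : StrongDual ℂ B →ₗ[ℂ] A)).topologicalClosure
  have hKc : IsClosed (K : Set A) := Submodule.isClosed_topologicalClosure _
  have hK : ∀ ω ∈ C, r ω ∈ K := fun ω hω =>
    Submodule.le_topologicalClosure _ (Submodule.mem_map_of_mem hω)
  set ω := θ ∘L R with hωdef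
  have hω : ω ∈ C := hRC θ hθ
  have hωc : Continuous fun t => ω ∘L τ t := hCcont hω
  have hmem : ∀ ε : ℝ, 0 < ε → r' (smear τ ε 0 ω ∘L R) ∈ K := fun ε hε => by
    rw [hr ω hω ε hε, smear, ← r.integral_comp_comm (integrable_gauss_smul _
      (f := fun s => ω ∘L τ (ε * s)) (hωc.comp (continuous_const_mul ε))
      fun s => norm_comp_le_of_contraction hτ ω _)]
    exact integral_mem_of_isClosed hKc fun s => hK _ (C.smul_mem _ (hCinv ω hω _))
  have hlim : Tendsto (fun ε => r' (smear τ ε 0 ω ∘L R)) (𝓝[>] 0)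
      (𝓝 (r' (((∫ s, gauss 0 s) • ω) ∘L R))) :=
    ((r'.continuous.comp (continuous_id.clm_comp (continuous_const (y := R)))).tendsto _).comp
      (tendsto_smear hτ h0 (hCcont hω))
  have hfin := hKc.mem_of_tendsto hlim (eventually_mem_nhdsWithin.mono fun ε hε => hmem ε hε)
  rw [ContinuousLinearMap.smul_comp, hωdef, ContinuousLinearMap.comp_assoc, hRR,
    ContinuousLinearMap.comp_id, map_smul] at hfin
  exact (K.smul_mem_iff integral_gauss_zero_ne_zero).1 hfin

end Smearing

/-! ### One-parameter groups of automorphisms of `B(H)` -/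

section Automorphisms

variable {H : Type*} [NormedAddCommGroup H] [InnerProductSpace ℂ H]

/-- A weakly bounded family of operators is norm bounded. -/
theorem exists_norm_le_of_inner_bounded [CompleteSpace H] {ι : Type*} {F : ι → H →L[ℂ] H}
    (h : ∀ ξ η : H, ∃ M : ℝ, ∀ i, ‖⟪η, F i ξ⟫_ℂ‖ ≤ M) : ∃ M : ℝ, ∀ i, ‖F i‖ ≤ M := by
  refine banach_steinhaus fun ξ => ?_
  obtain ⟨M, hM⟩ := banach_steinhaus (g := fun i => innerSL ℂ (F i ξ)) fun η => by
    obtain ⟨M, hM⟩ := h ξ η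
    exact ⟨M, fun i => by rw [innerSL_apply_apply, norm_inner_symm]; exact hM i⟩
  exact ⟨M, fun i => by simpa using hM i⟩

theorem norm_vectorFunctional_sub_le {u v : H} (h : ‖u‖ = ‖v‖) :
    ‖vectorFunctional u u - vectorFunctional v v‖ ≤ 2 * ‖v‖ * ‖u - v‖ := by
  have e : vectorFunctional u u - vectorFunctional v v =
      vectorFunctional u (u - v) + vectorFunctional (u - v) v := by
    ext T
    simp only [sub_apply, add_apply, vectorFunctional_apply, map_sub, inner_sub_left,
      inner_sub_right]
    ring
  rw [e]
  refine (norm_add_le (vectorFunctional u (u - v)) (vectorFunctional (u - v) v)).trans ?_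
  calc _ ≤ ‖u‖ * ‖u - v‖ + ‖u - v‖ * ‖v‖ :=
        add_le_add (norm_vectorFunctional_le _ _) (norm_vectorFunctional_le _ _)
    _ = 2 * ‖v‖ * ‖u - v‖ := by rw [h]; ring

variable [CompleteSpace H]

/-- If `τ` is implemented by `U`, then `⟪ζ, τ |ζ⟩⟨ζ| ζ⟫` is the transition probability between
`U* ζ` and `ζ`; it controls the distance of `U* ζ` to `ζ` up to a phase, and the phase does not
change the vector functional. -/
theorem norm_vectorFunctional_comp_autCLM_sub_le (τ : (H →L[ℂ] H) ≃⋆ₐ[ℂ] (H →L[ℂ] H)) (ζ : H) :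
    ‖vectorFunctional ζ ζ ∘L autCLM τ - vectorFunctional ζ ζ‖ ≤
      2 * ‖ζ‖ * √(2 * ‖ζ‖ ^ 2 - 2 * √‖vectorFunctional ζ ζ (τ (rankOne ℂ ζ ζ))‖) := by
  obtain ⟨U, hU⟩ := exists_unitary_implementing τ
  set v := U.symm ζ with hv
  have hvn : ‖v‖ = ‖ζ‖ := by simp [hv]
  obtain ⟨c, hc, hcv⟩ := Complex.exists_norm_eq_mul_self ⟪ζ, v⟫_ℂ
  have hcn : ‖c • v‖ = ‖ζ‖ := by rw [norm_smul, hc, one_mul, hvn]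
  have e : vectorFunctional ζ ζ ∘L autCLM τ = vectorFunctional (c • v) (c • v) := by
    ext T
    rw [ContinuousLinearMap.comp_apply, autCLM_apply, vectorFunctional_apply,
      vectorFunctional_apply, hU, map_smul, inner_smul_left, inner_smul_right, ← mul_assoc,
      Complex.conj_mul', hc]
    simp [hv]
  have e2 : √‖vectorFunctional ζ ζ (τ (rankOne ℂ ζ ζ))‖ = ‖⟪ζ, v⟫_ℂ‖ := by
    rw [vectorFunctional_apply, hU, rankOne_apply, inner_smul_right, norm_mul,
      norm_inner_symm (U.symm ζ) ζ]
    exact Real.sqrt_mul_self (norm_nonneg _)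
  have e3 : ‖c • v - ζ‖ ^ 2 = 2 * ‖ζ‖ ^ 2 - 2 * ‖⟪ζ, v⟫_ℂ‖ := by
    rw [@norm_sub_sq ℂ, hcn, ← inner_re_symm, inner_smul_right, ← hcv]
    simp
    ring
  rw [e, e2, ← e3, Real.sqrt_sq (norm_nonneg _)]
  exact norm_vectorFunctional_sub_le hcn

namespace IsOneParameterGroup

variable {τ : ℝ → ((H →L[ℂ] H) ≃⋆ₐ[ℂ] (H →L[ℂ] H))}

theorem autCLM_add (hτ : IsOneParameterGroup τ) (s t : ℝ) :
    autCLM (τ (s + t)) = autCLM (τ s) ∘L autCLM (τ t) :=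
  ContinuousLinearMap.ext fun x => hτ.add s t x

theorem autCLM_zero (hτ : IsOneParameterGroup τ) :
    autCLM (τ 0) = ContinuousLinearMap.id ℂ (H →L[ℂ] H) :=
  ContinuousLinearMap.ext fun x => hτ.zero x

/-- A σ-weakly continuous one-parameter group of automorphisms of `B(H)` acts norm continuously on
the predual. -/
theorem predualSubmodule_le (hτ : IsOneParameterGroup τ) :
    predualSubmodule H ≤ normContinuousFunctionals fun t => autCLM (τ t) := by
  refine predual_subset_of_vectorFunctional_mem
    (isClosed_normContinuousFunctionals fun t => norm_autCLM_le (τ t)) fun ζ => ?_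
  refine mem_normContinuousFunctionals_of_tendsto hτ.autCLM_add ?_
  rw [tendsto_iff_norm_sub_tendsto_zero]
  refine squeeze_zero (fun t => norm_nonneg (vectorFunctional ζ ζ ∘L autCLM (τ t) -
    vectorFunctional ζ ζ)) (fun t => norm_vectorFunctional_comp_autCLM_sub_le (τ t) ζ) ?_
  have hc := hτ.continuous (rankOne ℂ ζ ζ) _ (vectorFunctional_mem_predual ζ ζ)
  have hc' : Continuous fun t => 2 * ‖ζ‖ *
      √(2 * ‖ζ‖ ^ 2 - 2 * √‖vectorFunctional ζ ζ (τ t (rankOne ℂ ζ ζ))‖) := by fun_prop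
  convert hc'.tendsto 0
  have h0 : √‖vectorFunctional ζ ζ (τ 0 (rankOne ℂ ζ ζ))‖ = ‖ζ‖ ^ 2 := by
    rw [hτ.zero, vectorFunctional_apply, rankOne_apply, inner_smul_right, norm_mul,
      inner_self_eq_norm_sq_to_K]
    simp [Real.sqrt_mul_self]
  rw [h0]
  simp

end IsOneParameterGroup

theorem IsAnalyticExtension.smear_apply {τ : ℝ → ((H →L[ℂ] H) ≃⋆ₐ[ℂ] (H →L[ℂ] H))}
    (hτ : IsOneParameterGroup τ) {x x' : H →L[ℂ] H}
    (h : IsAnalyticExtension τ (-Complex.I / 2) x x') {ω : StrongDual ℂ (H →L[ℂ] H)}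
    (hω : ω ∈ predual H) {ε : ℝ} (hε : 0 < ε) :
    smear (fun t => autCLM (τ t)) ε 0 ω x' =
      smear (fun t => autCLM (τ t)) ε (-Complex.I / 2 / ε) ω x := by
  obtain ⟨F, hFx, rfl, hF⟩ := h
  have him : (-Complex.I / 2).im = -(1 / 2) := by simp; norm_num
  rw [him, Set.uIcc_of_ge (by norm_num), Set.uIoo_of_ge (by norm_num)] at hF
  refine smear_apply_analytic (fun t => norm_autCLM_le (τ t)) hτ.autCLM_add
    (C := predualSubmodule H) (fun ω hω t => comp_autCLM_mem_predual (τ t) hω)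
    (a := 1 / 2) (by norm_num) hFx (fun r => ?_) hF hω (hτ.predualSubmodule_le hω) hε
    (by rw [him]; norm_num)
  -- `F` is σ-weakly bounded on compact sets, hence norm bounded by uniform boundedness
  have hcpt : IsCompact ({z : ℂ | z.im ∈ Set.Icc (-(1 / 2)) 0} ∩ Metric.closedBall 0 r) :=
    (isCompact_closedBall 0 r).inter_left (isClosed_Icc.preimage Complex.continuous_im)
  obtain ⟨M, hM⟩ := exists_norm_le_of_inner_bounded
    (F := fun z : ({z : ℂ | z.im ∈ Set.Icc (-(1 / 2)) 0} ∩ Metric.closedBall 0 r : Set ℂ) => F z)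
    fun ξ η => by
      obtain ⟨M, hM⟩ := hcpt.exists_bound_of_continuousOn
        ((hF _ (vectorFunctional_mem_predual ξ η)).1.mono Set.inter_subset_left)
      exact ⟨M, fun z => hM z z.2⟩
  exact ⟨M, fun z hz hzr => hM ⟨z, hz, by simpa using hzr⟩⟩

end Automorphisms

/-! ### Slices -/

section Slices

variable {H : Type*} [NormedAddCommGroup H] [InnerProductSpace ℂ H]

theorem ext_inner_apply {S T : H →L[ℂ] H} (h : ∀ b a, ⟪b, S a⟫_ℂ = ⟪b, T a⟫_ℂ) : S = T :=
  ContinuousLinearMap.ext fun a => ext_inner_left ℂ fun b => h b a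

theorem norm_le_of_norm_inner_le {T : H →L[ℂ] H} {M : ℝ} (hM : 0 ≤ M)
    (h : ∀ b a, ‖⟪b, T a⟫_ℂ‖ ≤ M * ‖b‖ * ‖a‖) : ‖T‖ ≤ M := by
  refine T.opNorm_le_bound hM fun a => ?_
  by_cases h0 : ‖T a‖ = 0
  · rw [h0]; positivity
  · have h1 := h (T a) a
    rw [inner_self_eq_norm_sq_to_K, norm_pow, RCLike.norm_ofReal, abs_norm, sq] at h1
    have h2 : 0 < ‖T a‖ := lt_of_le_of_ne (norm_nonneg _) (Ne.symm h0)
    nlinarith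

/-- A map from functionals to operators whose matrix coefficients are `ω ↦ ω (X b a)` for a bounded
family of operators `X b a` is a bounded linear map. -/
theorem exists_clm_of_inner {r : StrongDual ℂ (H →L[ℂ] H) → (H →L[ℂ] H)} {X : H → H → H →L[ℂ] H}
    (h : ∀ ω b a, ⟪b, r ω a⟫_ℂ = ω (X b a)) {M : ℝ} (hM : 0 ≤ M)
    (hX : ∀ b a, ‖X b a‖ ≤ M * ‖b‖ * ‖a‖) :
    ∃ r' : StrongDual ℂ (H →L[ℂ] H) →L[ℂ] (H →L[ℂ] H), ∀ ω, r' ω = r ω := by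
  refine ⟨LinearMap.mkContinuous
    { toFun := r
      map_add' := fun ω ω' => ext_inner_apply fun b a => by
        rw [h, add_apply, add_apply, inner_add_right, h, h]
      map_smul' := fun c ω => ext_inner_apply fun b a => by
        rw [h, smul_apply, RingHom.id_apply, smul_apply, inner_smul_right, h, smul_eq_mul] }
    M fun ω => norm_le_of_norm_inner_le (mul_nonneg hM (norm_nonneg ω)) fun b a => ?_,
    fun ω => rfl⟩
  change ‖⟪b, r ω a⟫_ℂ‖ ≤ _
  rw [h]
  calc ‖ω (X b a)‖ ≤ ‖ω‖ * ‖X b a‖ := ω.le_opNorm _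
    _ ≤ ‖ω‖ * (M * ‖b‖ * ‖a‖) := mul_le_mul_of_nonneg_left (hX b a) (norm_nonneg ω)
    _ = M * ‖ω‖ * ‖b‖ * ‖a‖ := by ring

variable [CompleteSpace H]

/-- If `S` has a polar decomposition and maps `X b a` to `Y b a` for all `b` and `a`, and if `r` and
`r'` are the maps with the matrix coefficients `ω ↦ ω (X b a)` and `ω ↦ ω (Y b a)`, then `r'` maps
normal functionals into the norm closure of the image of the predual under `r`. -/
theorem HasPolarDecomposition.mem_closure_image {S : (H →L[ℂ] H) →ₗ.[ℂ] (H →L[ℂ] H)}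
    (hS : HasPolarDecomposition S) {X Y : H → H → H →L[ℂ] H}
    (hXY : ∀ b a, (X b a, Y b a) ∈ S.graph)
    {r r' : StrongDual ℂ (H →L[ℂ] H) → (H →L[ℂ] H)}
    (hr : ∀ ω b a, ⟪b, r ω a⟫_ℂ = ω (X b a)) (hr' : ∀ ω b a, ⟪b, r' ω a⟫_ℂ = ω (Y b a))
    {M : ℝ} (hM : 0 ≤ M) (hX : ∀ b a, ‖X b a‖ ≤ M * ‖b‖ * ‖a‖)
    (hY : ∀ b a, ‖Y b a‖ ≤ M * ‖b‖ * ‖a‖)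
    {θ : StrongDual ℂ (H →L[ℂ] H)} (hθ : θ ∈ predual H) : r' θ ∈ closure (r '' predual H) := by
  obtain ⟨R₀, τ, hR₀, hτ, hgraph⟩ := hS
  obtain ⟨R, hR, hRn⟩ := hR₀.exists_normal
  obtain ⟨ρ, hρ⟩ := exists_clm_of_inner hr hM hX
  obtain ⟨ρ', hρ'⟩ := exists_clm_of_inner hr' hM hY
  have hρr : r = ρ := funext fun ω => (hρ ω).symm
  rw [← hρ', hρr]
  refine mem_closure_image_of_smear (τ := fun t => autCLM (τ t)) (C := predualSubmodule H)
    (R := R) (w := -Complex.I / 2) (fun t => norm_autCLM_le (τ t)) hτ.autCLM_zero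
    (fun ω hω t => comp_autCLM_mem_predual (τ t) hω) hτ.predualSubmodule_le hRn
    (ContinuousLinearMap.ext fun x => by simp [hR, hR₀.involutive]) (fun ω hω ε hε => ?_) hθ
  refine ext_inner_apply fun b a => ?_
  obtain ⟨x', hx', hy⟩ := (hgraph _ _).1 (hXY b a)
  rw [hρ, hρ', hr, hr', ContinuousLinearMap.comp_apply, hy, hR, hR₀.involutive,
    hx'.smear_apply hτ hω hε]

theorem norm_ketRight_adjoint_comp_le (V : HTensor H H →L[ℂ] HTensor H H) (b a : H) :
    ‖(ketRight b).adjoint ∘L V ∘L ketRight a‖ ≤ ‖V‖ * ‖b‖ * ‖a‖ := by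
  calc _ ≤ ‖(ketRight b : H →L[ℂ] HTensor H H).adjoint‖ *
          (‖V‖ * ‖(ketRight a : H →L[ℂ] HTensor H H)‖) :=
        (ContinuousLinearMap.opNorm_comp_le _ _).trans
          (mul_le_mul_of_nonneg_left (ContinuousLinearMap.opNorm_comp_le _ _) (norm_nonneg _))
    _ ≤ ‖b‖ * (‖V‖ * ‖a‖) := by
        rw [LinearIsometryEquiv.norm_map]
        gcongr
        · exact norm_ketRight_le b
        · exact norm_ketRight_le a
    _ = _ := by ring

theorem norm_ketLeft_adjoint_comp_le (V : HTensor H H →L[ℂ] HTensor H H) (b a : H) :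
    ‖(ketLeft b).adjoint ∘L V ∘L ketLeft a‖ ≤ ‖V‖ * ‖b‖ * ‖a‖ := by
  calc _ ≤ ‖(ketLeft b : H →L[ℂ] HTensor H H).adjoint‖ *
          (‖V‖ * ‖(ketLeft a : H →L[ℂ] HTensor H H)‖) :=
        (ContinuousLinearMap.opNorm_comp_le _ _).trans
          (mul_le_mul_of_nonneg_left (ContinuousLinearMap.opNorm_comp_le _ _) (norm_nonneg _))
    _ ≤ ‖b‖ * (‖V‖ * ‖a‖) := by
        rw [LinearIsometryEquiv.norm_map]
        gcongr
        · exact norm_ketLeft_le b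
        · exact norm_ketLeft_le a
    _ = _ := by ring

/-- The matrix coefficients of the slices of one leg are applied to the operators
`(ketRight b)* V (ketRight a)`, which are themselves slices from the other leg. -/
theorem leftSlice_vectorFunctional (V : HTensor H H →L[ℂ] HTensor H H) (b a : H) :
    leftSlice (vectorFunctional a b) V = (ketRight b).adjoint ∘L V ∘L ketRight a :=
  ext_inner_apply fun d c => by
    simp only [inner_leftSlice, vectorFunctional_apply, ContinuousLinearMap.comp_apply,
      ContinuousLinearMap.adjoint_inner_right, ketLeft_apply, ketRight_apply]

theorem rightSlice_vectorFunctional (V : HTensor H H →L[ℂ] HTensor H H) (b a : H) :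
    rightSlice (vectorFunctional a b) V = (ketLeft b).adjoint ∘L V ∘L ketLeft a :=
  ext_inner_apply fun d c => by
    simp only [inner_rightSlice, vectorFunctional_apply, ContinuousLinearMap.comp_apply,
      ContinuousLinearMap.adjoint_inner_right, ketLeft_apply, ketRight_apply]

theorem star_adjoint_comp {K : Type*} [NormedAddCommGroup K] [InnerProductSpace ℂ K]
    [CompleteSpace K] (V : K →L[ℂ] K) (P Q : H →L[ℂ] K) :
    star (P.adjoint ∘L V ∘L Q) = Q.adjoint ∘L star V ∘L P := by
  simp only [ContinuousLinearMap.star_eq_adjoint, ContinuousLinearMap.adjoint_comp,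
    ContinuousLinearMap.adjoint_adjoint, ContinuousLinearMap.comp_assoc]

theorem star_rightSlice {ω ω' : StrongDual ℂ (H →L[ℂ] H)} (h : ∀ x, ω' x = conj (ω (star x)))
    (V : HTensor H H →L[ℂ] HTensor H H) : star (rightSlice ω V) = rightSlice ω' (star V) :=
  ext_inner_apply fun b a => by
    rw [ContinuousLinearMap.star_eq_adjoint, ContinuousLinearMap.adjoint_inner_right,
      ← inner_conj_symm, inner_rightSlice, inner_rightSlice, h, star_adjoint_comp, star_star]

theorem star_leftSlice {ω ω' : StrongDual ℂ (H →L[ℂ] H)} (h : ∀ x, ω' x = conj (ω (star x)))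
    (V : HTensor H H →L[ℂ] HTensor H H) : star (leftSlice ω V) = leftSlice ω' (star V) :=
  ext_inner_apply fun b a => by
    rw [ContinuousLinearMap.star_eq_adjoint, ContinuousLinearMap.adjoint_inner_right,
      ← inner_conj_symm, inner_leftSlice, inner_leftSlice, h, star_adjoint_comp, star_star]

theorem rightLeg_eq_image (V : HTensor H H →L[ℂ] HTensor H H) :
    rightLeg V = (fun ω => rightSlice ω V) '' predual H :=
  Set.ext fun _ => ⟨fun ⟨ω, h, e⟩ => ⟨ω, h, e.symm⟩, fun ⟨ω, h, e⟩ => ⟨ω, h, e.symm⟩⟩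

theorem leftLeg_eq_image (V : HTensor H H →L[ℂ] HTensor H H) :
    leftLeg V = (fun ω => leftSlice ω V) '' predual H :=
  Set.ext fun _ => ⟨fun ⟨ω, h, e⟩ => ⟨ω, h, e.symm⟩, fun ⟨ω, h, e⟩ => ⟨ω, h, e.symm⟩⟩

theorem HasManageableAntipodes.star_mem_closure_rightLeg {V : HTensor H H →L[ℂ] HTensor H H}
    (hV : HasManageableAntipodes V) : ∀ x ∈ rightLeg V, star x ∈ closure (rightLeg V) := by
  rintro x ⟨ω, hω, rfl⟩
  obtain ⟨ω', hω', h⟩ := exists_conj_mem_predual hω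
  obtain ⟨S, hS, hgraph⟩ := hV.left
  rw [star_rightSlice h, rightLeg_eq_image]
  refine hS.mem_closure_image (X := fun b a => (ketRight b).adjoint ∘L V ∘L ketRight a)
    (Y := fun b a => (ketRight b).adjoint ∘L star V ∘L ketRight a)
    (r' := fun ω => rightSlice ω (star V)) (fun b a => ?_)
    (fun ω b a => inner_rightSlice ω V b a) (fun ω b a => inner_rightSlice ω (star V) b a)
    (norm_nonneg V) (norm_ketRight_adjoint_comp_le V)
    (fun b a => (norm_ketRight_adjoint_comp_le (star V) b a).trans_eq (by
      rw [ContinuousLinearMap.star_eq_adjoint, LinearIsometryEquiv.norm_map])) hω'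
  have h1 := hgraph _ (vectorFunctional_mem_predual a b)
  rwa [leftSlice_vectorFunctional, leftSlice_vectorFunctional] at h1

theorem HasManageableAntipodes.star_mem_closure_leftLeg {V : HTensor H H →L[ℂ] HTensor H H}
    (hV : HasManageableAntipodes V) : ∀ x ∈ leftLeg V, star x ∈ closure (leftLeg V) := by
  rintro x ⟨ω, hω, rfl⟩
  obtain ⟨ω', hω', h⟩ := exists_conj_mem_predual hω
  obtain ⟨S, hS, hgraph⟩ := hV.right
  rw [star_leftSlice h, leftLeg_eq_image]
  refine hS.mem_closure_image (X := fun b a => (ketLeft b).adjoint ∘L V ∘L ketLeft a)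
    (Y := fun b a => (ketLeft b).adjoint ∘L star V ∘L ketLeft a)
    (r' := fun ω => leftSlice ω (star V)) (fun b a => ?_)
    (fun ω b a => inner_leftSlice ω V b a) (fun ω b a => inner_leftSlice ω (star V) b a)
    (norm_nonneg V) (norm_ketLeft_adjoint_comp_le V)
    (fun b a => (norm_ketLeft_adjoint_comp_le (star V) b a).trans_eq (by
      rw [ContinuousLinearMap.star_eq_adjoint, LinearIsometryEquiv.norm_map])) hω'
  have h1 := hgraph _ (vectorFunctional_mem_predual a b)
  rwa [rightSlice_vectorFunctional, rightSlice_vectorFunctional] at h1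

end Slices

/-! ### Closures of self-adjoint sets -/

section Closures

variable {H : Type*} [NormedAddCommGroup H] [InnerProductSpace ℂ H]

theorem continuous_apply_sigmaWeakTopology {ω : StrongDual ℂ (H →L[ℂ] H)} (hω : ω ∈ predual H) :
    Continuous[sigmaWeakTopology H, _] fun x => ω x :=
  continuous_iff_le_induced.2 (iInf₂_le ω hω)

theorem closure_subset_sigmaWeakClosure (A : Set (H →L[ℂ] H)) : closure A ⊆ sigmaWeakClosure A := by
  have hle : (inferInstance : TopologicalSpace (H →L[ℂ] H)) ≤ sigmaWeakTopology H :=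
    le_iInf₂ fun ω _ => continuous_iff_le_induced.1 ω.continuous
  exact closure_minimal (@subset_closure _ (sigmaWeakTopology H) A)
    ((@isClosed_closure _ (sigmaWeakTopology H) A).mono hle)

variable [CompleteSpace H]

theorem isSelfAdjointSet_closure {A : Set (H →L[ℂ] H)} (hA : ∀ x ∈ A, star x ∈ closure A) :
    IsSelfAdjointSet (closure A) := fun x hx => by
  have h := map_mem_closure continuous_star hx hA
  rwa [closure_closure] at h

theorem continuous_star_sigmaWeakTopology :
    Continuous[sigmaWeakTopology H, sigmaWeakTopology H] (star : (H →L[ℂ] H) → (H →L[ℂ] H)) := by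
  refine continuous_iInf_rng.2 fun ω => continuous_iInf_rng.2 fun hω => continuous_induced_rng.2 ?_
  obtain ⟨ω', hω', h⟩ := exists_conj_mem_predual hω
  have e : (fun x => ω x) ∘ star = fun x => conj (ω' x) := funext fun x => by
    simp [h]
  rw [e]
  exact @Continuous.comp _ _ _ (sigmaWeakTopology H) _ _ _ _ Complex.continuous_conj
    (continuous_apply_sigmaWeakTopology hω')

theorem isSelfAdjointSet_sigmaWeakClosure {A : Set (H →L[ℂ] H)}
    (hA : ∀ x ∈ A, star x ∈ closure A) : IsSelfAdjointSet (sigmaWeakClosure A) := fun x hx => by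
  have h := @map_mem_closure _ _ (sigmaWeakTopology H) (sigmaWeakTopology H) _ _ _ _
    continuous_star_sigmaWeakTopology hx
    fun y hy => closure_subset_sigmaWeakClosure A (hA y hy)
  rwa [sigmaWeakClosure, @closure_closure _ (sigmaWeakTopology H)] at h

end Closures

end MultUnitary

end

theorem proposition5 {H : Type*} [NormedAddCommGroup H] [InnerProductSpace ℂ H] [CompleteSpace H]
    (V : MultUnitary.HTensor H H →L[ℂ] MultUnitary.HTensor H H)
    (hV : MultUnitary.HasManageableAntipodes V) :
    MultUnitary.IsSelfAdjointSet (closure (MultUnitary.rightLeg V)) ∧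
    MultUnitary.IsSelfAdjointSet (closure (MultUnitary.leftLeg V)) ∧
    MultUnitary.IsSelfAdjointSet (MultUnitary.sigmaWeakClosure (MultUnitary.rightLeg V)) ∧
    MultUnitary.IsSelfAdjointSet (MultUnitary.sigmaWeakClosure (MultUnitary.leftLeg V)) :=
  ⟨MultUnitary.isSelfAdjointSet_closure hV.star_mem_closure_rightLeg,
    MultUnitary.isSelfAdjointSet_closure hV.star_mem_closure_leftLeg,
    MultUnitary.isSelfAdjointSet_sigmaWeakClosure hV.star_mem_closure_rightLeg,
    MultUnitary.isSelfAdjointSet_sigmaWeakClosure hV.star_mem_closure_leftLeg⟩
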